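/- **Theorem (AODV does not satisfy the property packet delivery).** Let $\mathrm{IP}$ be a set of addresses with at least three elements and $\mathrm{DATA}$ a nonempty set of data packets. Consider the following model of the AODV routing protocol in the process algebra AWN. *Node state.* A node with address $ip$ runs a main process in parallel with a FIFO message queue. The main process maintains an own sequence number $sn$, a routing table $rt$ (a partial function mapping a destination to its sequence number, known/unknown status $\mathsf{kno}/\mathsf{unk}$, validity $\mathsf{val}/\mathsf{inval}$, hop count, next hop and set of precursors), a set $rreqs$ of handled route requests $(oip,rreqid)$, and a store of queued data packets (a partial function mapping a destination to a request-required flag $\mathsf{req}/\mathsf{noreq}$ and a list of packets). Initially $sn=1$ and $rt$, $rreqs$, the store and the message queue are empty. Let $\mathrm{vD},\mathrm{iD}$ be the sets of destinations of valid, respectively invalid, entries of $rt$, and $\mathrm{qD}$ the set of destinations with queued packets. Put $\mathrm{inc}(0)=0$ and $\mathrm{inc}(n)=n+1$ for $n\ge 1$; the sequence number of an absent entry counts as $0$ with status $\mathsf{unk}$. Each step below is executed as a sequence of separate actions. *Update* of $rt$ with a valid entry $r$ for $dip$: if there is no entry, $r$ is inserted; if $r$ has a larger sequence number than the present entry $s$,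 or the same one and fewer hops, or the same one while $s$ is invalid, then $r$ replaces $s$ but also keeps the precursors of $s$; if otherwise $r$ has status $\mathsf{unk}$, it replaces $s$ but keeps the precursors and the sequence number of $s$; in all other cases only the precursors of $r$ are added to $s$. *Link break towards $x$* (after a failed unicast to the next hop for $x$): let $dests$ be the set of pairs $(rip,\mathrm{inc}(\text{sequence number of } rip))$ with $rip\in\mathrm{vD}$ that have the same next hop as $x$. *Report of $dests$*: invalidate the entries for $dests$, giving them the listed sequence numbers; set the request-required flags of existing queues for $dests$ to $\mathsf{req}$; groupcast an error message $\mathrm{rerr}(dests',ip)$ to all precursors of the entries for $dests$, where $dests'$ consists of those members of $dests$ whose set of precursors is nonempty. *Main process* (repeatedly, by nondeterministic choice): (a) receive the first message of the message queue and handle it as described below; (b) for some $dip\in\mathrm{qD}\cap\mathrm{vD}$, unicast $\mathrm{pkt}(d,dip,ip)$, with $d$ the oldest queued packet for $dip$, to the next hop for $dip$; on success drop $d$ from the queue (removing the queue with its flag if it becomes empty), on failure do the link-break routine towards $dip$; (c) for some $dip\in\mathrm{qD}\setminus\mathrm{vD}$ with flag $\mathsf{req}$, set this flag to $\mathsf{noreq}$,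 increment $sn$, choose the fresh identifier $rreqid=\max\{n\mid (ip,n)\in rreqs\}+1$ (with $\max\emptyset=0$), add $(ip,rreqid)$ to $rreqs$, and broadcast $\mathrm{rreq}(0,rreqid,dip,dsn,dsk,ip,sn,ip)$, where $dsn$, $dsk$ are the sequence number and status for $dip$ in $rt$. *Message handling.* $\mathrm{newpkt}(d,dip)$: deliver $d$ if $dip=ip$; otherwise append $d$ to the queue for $dip$ (a new queue has flag $\mathsf{req}$). $\mathrm{pkt}(d,dip,oip)$: deliver $d$ if $dip=ip$; otherwise, if $dip\in\mathrm{vD}$, unicast the message to the next hop for $dip$, doing the link-break routine towards $dip$ on failure; if $dip\in\mathrm{iD}$, groupcast $\mathrm{rerr}(\{(dip,\text{its sequence number})\},ip)$ to the precursors of the entry for $dip$; else do nothing. On receipt of an rreq, rrep or rerr from neighbour $sip$, first update $rt$ with the entry $(sip,0,\mathsf{unk},\mathsf{val},1,sip,\emptyset)$; then proceed as follows. $\mathrm{rreq}(hops,rreqid,dip,dsn,dsk,oip,osn,sip)$: ignore it if $(oip,rreqid)\in rreqs$. Otherwise update $rt$ with $(oip,osn,\mathsf{kno},\mathsf{val},hops+1,sip,\emptyset)$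 and add $(oip,rreqid)$ to $rreqs$. If $dip=ip$, set $sn:=\max(sn,dsn)$ and unicast $\mathrm{rrep}(0,dip,sn,oip,ip)$ to the next hop for $oip$. If $dip\ne ip$ and there is a valid entry for $dip$ with status $\mathsf{kno}$ and sequence number $\ge dsn$, add $sip$ to the precursors of $dip$ and the next hop for $dip$ to the precursors of $oip$, and unicast $\mathrm{rrep}(\text{hop count of }dip,dip,\text{sequence number of }dip,oip,ip)$ to the next hop for $oip$. Otherwise broadcast $\mathrm{rreq}(hops+1,rreqid,dip,\max(\text{sequence number of }dip,dsn),dsk,oip,osn,ip)$. $\mathrm{rrep}(hops,dip,dsn,oip,sip)$: ignore it if the update of $rt$ with $(dip,dsn,\mathsf{kno},\mathsf{val},hops+1,sip,\emptyset)$ leaves $rt$ unchanged. Otherwise perform this update; if then $oip\neq ip$ and $oip\in\mathrm{vD}$, add the next hop for $oip$ to the precursors of $dip$ and to those of the next hop for $dip$, and unicast $\mathrm{rrep}(hops+1,dip,dsn,oip,ip)$ to the next hop for $oip$. Failed unicasts of route replies lead to the link-break routine towards $oip$. $\mathrm{rerr}(dests,sip)$: report the set of those $(rip,rsn)\in dests$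 for which $rip\in \mathrm{vD}$, the next hop for $rip$ is $sip$, and the sequence number of $rip$ in $rt$ is smaller than $rsn$. *Networks.* A network is a nonempty finite parallel composition of nodes with distinct addresses, each with a transmission range (a set of addresses). Initially the ranges form a symmetric, irreflexive relation on the nodes of the network. A message that is broadcast, or groupcast to a set of addresses, is received in the message queue of exactly the addressed nodes in range; a unicast succeeds iff its target is in range. At any time the environment may add or remove a link between two addresses (actions $\mathbf{connect}(x,y)$, $\mathbf{disconnect}(x,y)$, changing the ranges of both), and a client may inject a packet ($ip:\mathbf{newpkt}(d,dip)$). Delivery of $d$ at node $ip$ is denoted $ip:\mathbf{deliver}(d)$. *Complete paths.* A path is *complete* if it is infinite or ends in a state that admits no internal or output transition (that is, no transition other than a connect, a disconnect, an injection of a packet, or, for a component, a receipt of or a synchronisation on a message), and if moreover it arises from paths of its parallel components that are complete in the same sense, recursively: no component that from some point on performs no transition may remain in a state in which it can perform an internal or output transition by itself. *Formulas.* LTL formulas are evaluated on a path by splitting each transition in two by a state halfway. At this halfway state a state property holds iff it holds in the target state; a property of a transition holds at its halfway state only. $\mathbf{connected}^*(x,y)$ says that there is a chain of nodes, each in range of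 the preceding one, from $x$ to $y$. $\mathrm{qD}^{x}$, $\mathrm{vD}^{x}$ and $\mathrm{flag}^{x}(y)$ refer to the current data state of node $x$. $\mathbf{disconnect}(*,*)$ says that a link is removed. *Fairness.* A complete path is fair if for all $ip,dip\in \mathrm{IP}$ it satisfies $$\mathbf G\big(\mathbf G(dip\in\mathrm{qD}^{ip}\cap\mathrm{vD}^{ip})\Rightarrow\mathbf F(ip\text{ tries to unicast a packet } \mathrm{pkt}(*,dip,ip))\big),$$ $$\mathbf G\big(\mathbf G(dip\in\mathrm{qD}^{ip}\setminus\mathrm{vD}^{ip}\wedge\mathrm{flag}^{ip}(dip)=\mathsf{req})\Rightarrow\mathbf F(ip\text{ broadcasts } \mathrm{rreq}(*,*,dip,*,*,ip,*,ip))\big),$$ $$\mathbf G\big(\mathbf G(\text{the message queue of }ip\text{ is not empty})\Rightarrow\mathbf F(\text{the message queue of }ip\text{ hands a message to the main process})\big).$$ *Packet delivery* is the property $$\mathbf G\big(\mathbf G(dip\in\mathrm{qD}^{oip}\setminus\mathrm{vD}^{oip})\Rightarrow\mathbf F(\mathrm{flag}^{oip}(dip)=\mathsf{req})\big)\Rightarrow\mathbf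 G\Big(\mathbf{connected}^*(oip,dip)\Rightarrow\mathbf F\big(dip:\mathbf{deliver}(d)\vee\mathbf{disconnect}(*,*)\vee\neg\mathbf F(oip:\mathbf{newpkt}(d,dip))\big)\Big).\tag{PD$_3$}$$ Then AODV does not satisfy packet delivery: it is not the case that for every network in an initial state, all nodes $oip,dip$ of it and every $d\in\mathrm{DATA}$, all fair complete paths from the initial state satisfy (PD$_3$). In other words, there are such a network, $oip$, $dip$, $d$, and a fair complete path from the initial state that violates (PD$_3$). -/

import Mathlib

namespace AODV

noncomputable section

/-! ## Data structure -/

/-- Sequence-number-status flags: known / unknown. -/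
inductive SQNK | kno | unk
  deriving DecidableEq

/-- Validity of a routing table entry. -/
inductive Validity | val | inval
  deriving DecidableEq

/-- Request-required flag of a data queue: `req` says that a route request still has to be sent,
`noreq` that one has been sent already. -/
inductive ReqFlag | noreq | req
  deriving DecidableEq

/-- A routing table entry, without its first component (the destination). -/
@[ext] structure Route (IP : Type) where
  dsn : ℕ
  dsk : SQNK
  flag : Validity
  hops : ℕ
  nhip : IP
  pre : Set IP

/-- A routing table has at most one entry per destination: it is a partial function. -/
abbrev RT (IP : Type) := IP → Option (Route IP)

/-- A partial function from addresses to sequence numbers. -/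
abbrev Dests (IP : Type) := IP → Option ℕ

/-- A store has at most one (flagged) queue of data packets per destination. The head of the list
is the oldest packet. -/
abbrev Store (IP DATA : Type) := IP → Option (ReqFlag × List DATA)

/-- Messages: route requests, route replies, route errors, new data packets injected by a client,
and data packets travelling through the network. -/
inductive Msg (IP DATA : Type)
  | rreq (hops rreqid : ℕ) (dip : IP) (dsn : ℕ) (dsk : SQNK) (oip : IP) (osn : ℕ) (sip : IP)
  | rrep (hops : ℕ) (dip : IP) (dsn : ℕ) (oip sip : IP)
  | rerr (dests : Dests IP) (sip : IP)
  | newpkt (data : DATA) (dip : IP)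
  | pkt (data : DATA) (dip oip : IP)

section Data
variable {IP DATA : Type}

/-- Increment of a sequence number; the unknown sequence number `0` is not incremented. -/
def inc (n : ℕ) : ℕ := if n = 0 then 0 else n + 1

def sqn (rt : RT IP) (dip : IP) : ℕ := ((rt dip).map Route.dsn).getD 0
def sqnf (rt : RT IP) (dip : IP) : SQNK := ((rt dip).map Route.dsk).getD .unk
def dhops (rt : RT IP) (dip : IP) : Option ℕ := (rt dip).map Route.hops
def nhop (rt : RT IP) (dip : IP) : Option IP := (rt dip).map Route.nhip
def precs (rt : RT IP) (dip : IP) : Option (Set IP) := (rt dip).map Route.pre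

/-- Destinations of valid routes. -/
def vD (rt : RT IP) : Set IP := {dip | ∃ r, rt dip = some r ∧ r.flag = .val}
/-- Destinations of invalid routes. -/
def iD (rt : RT IP) : Set IP := {dip | ∃ r, rt dip = some r ∧ r.flag = .inval}

/-- Adds precursors to an entry. -/
def addpre (r : Route IP) (npre : Set IP) : Route IP := { r with pre := r.pre ∪ npre }

open scoped Classical in
/-- Adds precursors to the entry for `dip`; undefined if there is no such entry. -/
def addpreRT (rt : RT IP) (dip : IP) (npre : Set IP) : Option (RT IP) :=
  (rt dip).map fun r => Function.update rt dip (some (addpre r npre))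

open scoped Classical in
/-- Updates a routing table with an entry `r` for `dip`. Defined only if `r` is valid, its sequence
number is `0` iff its status is unknown, and its hop count is `1` if its status is unknown. -/
def update (rt : RT IP) (dip : IP) (r : Route IP) : Option (RT IP) :=
  if r.flag = .val ∧ (r.dsn = 0 ↔ r.dsk = .unk) ∧ (r.dsk = .unk → r.hops = 1) then
    some (Function.update rt dip (some (
      match rt dip with
      | none => r
      | some s =>
        if s.dsn < r.dsn then addpre r s.pre
        else if s.dsn = r.dsn ∧ s.hops > r.hops then addpre r s.pre
        else if s.dsn = r.dsn ∧ s.flag = .inval then addpre r s.pre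
        else if r.dsk = .unk then { addpre r s.pre with dsn := s.dsn }
        else addpre s r.pre)))
  else none

/-- Invalidates the entries for the destinations in `dests`, copying the sequence numbers. -/
def invalidate (rt : RT IP) (dests : Dests IP) : RT IP := fun dip =>
  match rt dip, dests dip with
  | some r, some rsn => some { r with dsn := rsn, flag := .inval }
  | o, _ => o

/-- A fresh route request identifier: `max {n | (ip, n) ∈ rreqs} + 1`, where `max ∅ = 0`. -/
def nrreqid (rreqs : Set (IP × ℕ)) (ip : IP) : ℕ := sSup {n | (ip, n) ∈ rreqs} + 1

/-- The queue for a destination. -/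
def selqueue (store : Store IP DATA) (dip : IP) : List DATA := ((store dip).map Prod.snd).getD []

/-- Destinations for which there are queued packets. -/
def qD (store : Store IP DATA) : Set IP := {dip | (store dip).isSome}

/-- The request-required flag of a queue. -/
def qflag (store : Store IP DATA) (dip : IP) : Option ReqFlag := (store dip).map Prod.fst

open scoped Classical in
/-- Appends a packet to the queue for `dip`. -/
def add (d : DATA) (dip : IP) (store : Store IP DATA) : Store IP DATA :=
  Function.update store dip (some (
    match store dip with
    | none => (.req, [d])
    | some (p, q) => (p, q ++ [d])))

open scoped Classical in
/-- Deletes the oldest packet for `dip`; the whole entry is removed if this was the last packet.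
Undefined if there is no queued packet for `dip`. -/
def drop (dip : IP) (store : Store IP DATA) : Option (Store IP DATA) :=
  match store dip with
  | none => none
  | some (_, []) => none
  | some (_, [_]) => some (Function.update store dip none)
  | some (p, _ :: d :: q) => some (Function.update store dip (some (p, d :: q)))

open scoped Classical in
/-- Sets the request-required flag for `dip` to `noreq`. -/
def unsetRRF (store : Store IP DATA) (dip : IP) : Store IP DATA :=
  Function.update store dip ((store dip).map fun pq => (.noreq, pq.2))

/-- Sets the request-required flag for all destinations in `dests` to `req`. -/
def setRRF (store : Store IP DATA) (dests : Dests IP) : Store IP DATA := fun dip =>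
  match store dip, dests dip with
  | some (_, q), some _ => some (.req, q)
  | o, _ => o

open scoped Classical in
/-- `{(rip, inc (sqn rt rip)) | rip ∈ vD rt ∧ nhop rt rip = nhop rt dst}`: the valid destinations
whose next hop is the next hop towards `dst`, with incremented sequence numbers. -/
def brokenDests (rt : RT IP) (dst : IP) : Dests IP := fun rip =>
  if rip ∈ vD rt ∧ nhop rt rip = nhop rt dst then some (inc (sqn rt rip)) else none

open scoped Classical in
/-- `{(rip, rsn) ∈ dests | rip ∈ vD rt ∧ nhop rt rip = sip ∧ sqn rt rip < rsn}`. -/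
def affectedDests (rt : RT IP) (dests : Dests IP) (sip : IP) : Dests IP := fun rip =>
  match dests rip with
  | some rsn => if rip ∈ vD rt ∧ nhop rt rip = some sip ∧ sqn rt rip < rsn then some rsn else none
  | none => none

/-- `⋃ {precs rt rip | (rip, *) ∈ dests}`. -/
def allPrecs (rt : RT IP) (dests : Dests IP) : Set IP :=
  {x | ∃ rip, (dests rip).isSome ∧ ∃ P, precs rt rip = some P ∧ x ∈ P}

open scoped Classical in
/-- `{(rip, rsn) ∈ dests | precs rt rip ≠ ∅}`. -/
def destsWithPrecs (rt : RT IP) (dests : Dests IP) : Dests IP := fun rip =>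
  if ∃ P, precs rt rip = some P ∧ P ≠ ∅ then dests rip else none

open scoped Classical in
/-- The partial function that is only defined at `dip`, with value `n`. -/
def singleDest (dip : IP) (n : ℕ) : Dests IP := Function.update (fun _ => none) dip (some n)

end Data

/-! ## Sequential processes -/

/-- Data variables. -/
inductive Var
  | ip | sn | rt | rreqs | store
  | msg | data | dip | oip | hops | rreqid | dsn | dsk | osn | sip | dests | pre
  | msgs
  deriving DecidableEq

/-- Types of the data variables. -/
@[reducible] def Ty (IP DATA : Type) : Var → Type
  | .ip => IP
  | .sn => ℕ
  | .rt => RT IP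
  | .rreqs => Set (IP × ℕ)
  | .store => Store IP DATA
  | .msg => Msg IP DATA
  | .data => DATA
  | .dip => IP
  | .oip => IP
  | .hops => ℕ
  | .rreqid => ℕ
  | .dsn => ℕ
  | .dsk => SQNK
  | .osn => ℕ
  | .sip => IP
  | .dests => Dests IP
  | .pre => Set IP
  | .msgs => List (Msg IP DATA)

/-- A valuation assigns values to some of the variables. -/
abbrev Valuation (IP DATA : Type) := (v : Var) → Option (Ty IP DATA v)

/-- A data expression, given by its (possibly undefined) value under each valuation. -/
abbrev Exp (IP DATA T : Type) := Valuation IP DATA → Option T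

/-- A data formula, given by its free variables and the valuations under which it holds. -/
structure Formula (IP DATA : Type) where
  free : Set Var
  holds : Valuation IP DATA → Prop

/-- Truth of a formula that may contain undefined subterms: undefined counts as false. -/
def truth (o : Option Prop) : Prop := o.getD False

/-- Process names. -/
inductive PName | AODV | NEWPKT | PKT | RREQ | RREP | RERR | QMSG
  deriving DecidableEq

/-- Sequential process expressions. The argument of `receive` is the only variable that ranges over
messages, `msg`. In a call, the `v`-th argument is the expression for the formal parameter `v`;
arguments for variables that are no formal parameters are ignored. -/
inductive SP (IP DATA : Type)
  | call (X : PName) (args : (v : Var) → Exp IP DATA (Ty IP DATA v))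
  | guard (φ : Formula IP DATA) (p : SP IP DATA)
  | assign (v : Var) (e : Exp IP DATA (Ty IP DATA v)) (p : SP IP DATA)
  | choice (p q : SP IP DATA)
  | broadcast (ms : Exp IP DATA (Msg IP DATA)) (p : SP IP DATA)
  | groupcast (dests : Exp IP DATA (Set IP)) (ms : Exp IP DATA (Msg IP DATA)) (p : SP IP DATA)
  | unicast (dest : Exp IP DATA IP) (ms : Exp IP DATA (Msg IP DATA)) (p q : SP IP DATA)
  | send (ms : Exp IP DATA (Msg IP DATA)) (p : SP IP DATA)
  | deliver (data : Exp IP DATA DATA) (p : SP IP DATA)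
  | receive (p : SP IP DATA)

/-- Formal parameters of the process names. -/
def params : PName → List Var
  | .AODV => [.ip, .sn, .rt, .rreqs, .store]
  | .NEWPKT => [.data, .dip, .ip, .sn, .rt, .rreqs, .store]
  | .PKT => [.data, .dip, .oip, .ip, .sn, .rt, .rreqs, .store]
  | .RREQ => [.hops, .rreqid, .dip, .dsn, .dsk, .oip, .osn, .sip, .ip, .sn, .rt, .rreqs, .store]
  | .RREP => [.hops, .dip, .dsn, .oip, .sip, .ip, .sn, .rt, .rreqs, .store]
  | .RERR => [.dests, .sip, .ip, .sn, .rt, .rreqs, .store]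
  | .QMSG => [.msgs]

section Specification
variable {IP DATA : Type}

/-- A call in which each formal parameter is instantiated by the variable of the same name. -/
def callSame (X : PName) : SP IP DATA := .call X fun v ξ => ξ v

/-- The call `QMSG(e)`. -/
def callQmsg (e : Exp IP DATA (List (Msg IP DATA))) : SP IP DATA :=
  .call .QMSG fun v =>
    match v with
    | .msgs => e
    | v => fun ξ => ξ v

/-- Handling of the unreachable destinations listed in `dests`: invalidate the corresponding
entries, set the request-required flags, and send an error message to the precursors. -/
def reportDests : SP IP DATA :=
  .assign .rt (fun ξ => do return invalidate (← ξ .rt) (← ξ .dests)) <|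
  .assign .store (fun ξ => do return setRRF (← ξ .store) (← ξ .dests)) <|
  .assign .pre (fun ξ => do return allPrecs (← ξ .rt) (← ξ .dests)) <|
  .assign .dests (fun ξ => do return destsWithPrecs (← ξ .rt) (← ξ .dests)) <|
  .groupcast (fun ξ => ξ .pre) (fun ξ => do return .rerr (← ξ .dests) (← ξ .ip)) <|
  callSame .AODV

/-- Reaction to a failed unicast to the next hop towards `dst`. -/
def linkBreak (dst : Exp IP DATA IP) : SP IP DATA :=
  .assign .dests (fun ξ => do return brokenDests (← ξ .rt) (← dst ξ)) reportDests

/-- `[rt := update(rt, (sip, 0, unk, val, 1, sip, ∅))] p`. -/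
def updateSender (p : SP IP DATA) : SP IP DATA :=
  .assign .rt (fun ξ => do
    update (← ξ .rt) (← ξ .sip) ⟨0, .unk, .val, 1, ← ξ .sip, ∅⟩) p

/-- The basic routine. -/
def bodyAODV : SP IP DATA :=
  .choice
    -- read a message from the queue and handle it, depending on its type
    (.receive <|
      .choice
        (.guard ⟨{.msg, .data, .dip}, fun ξ => truth do
            return (← ξ .msg) = .newpkt (← ξ .data) (← ξ .dip)⟩ <|
          callSame .NEWPKT) <|
      .choice
        (.guard ⟨{.msg, .data, .dip, .oip}, fun ξ => truth do
            return (← ξ .msg) = .pkt (← ξ .data) (← ξ .dip) (← ξ .oip)⟩ <|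
          callSame .PKT) <|
      .choice
        (.guard ⟨{.msg, .hops, .rreqid, .dip, .dsn, .dsk, .oip, .osn, .sip}, fun ξ => truth do
            return (← ξ .msg) = .rreq (← ξ .hops) (← ξ .rreqid) (← ξ .dip) (← ξ .dsn) (← ξ .dsk)
              (← ξ .oip) (← ξ .osn) (← ξ .sip)⟩ <|
          updateSender <| callSame .RREQ) <|
      .choice
        (.guard ⟨{.msg, .hops, .dip, .dsn, .oip, .sip}, fun ξ => truth do
            return (← ξ .msg) = .rrep (← ξ .hops) (← ξ .dip) (← ξ .dsn) (← ξ .oip) (← ξ .sip)⟩ <|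
          updateSender <| callSame .RREP)
        (.guard ⟨{.msg, .dests, .sip}, fun ξ => truth do
            return (← ξ .msg) = .rerr (← ξ .dests) (← ξ .sip)⟩ <|
          updateSender <| callSame .RERR)) <|
  .choice
    -- send a queued data packet if a valid route is known
    (.guard ⟨{.dip, .store, .rt}, fun ξ => truth do
        return (← ξ .dip) ∈ qD (← ξ .store) ∩ vD (← ξ .rt)⟩ <|
      .assign .data (fun ξ => do (selqueue (← ξ .store) (← ξ .dip)).head?) <|
      .unicast (fun ξ => do nhop (← ξ .rt) (← ξ .dip))
        (fun ξ => do return .pkt (← ξ .data) (← ξ .dip) (← ξ .ip))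
        (.assign .store (fun ξ => do drop (← ξ .dip) (← ξ .store)) <| callSame .AODV)
        (linkBreak fun ξ => ξ .dip))
    -- initiate a route discovery process
    (.guard ⟨{.dip, .store, .rt}, fun ξ =>
        truth (do return (← ξ .dip) ∈ qD (← ξ .store) \ vD (← ξ .rt)) ∧
        truth (do return (← qflag (← ξ .store) (← ξ .dip)) = .req)⟩ <|
      .assign .store (fun ξ => do return unsetRRF (← ξ .store) (← ξ .dip)) <|
      .assign .sn (fun ξ => do return inc (← ξ .sn)) <|
      .assign .rreqid (fun ξ => do return nrreqid (← ξ .rreqs) (← ξ .ip)) <|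
      .assign .rreqs (fun ξ => do return (← ξ .rreqs) ∪ {(← ξ .ip, ← ξ .rreqid)}) <|
      .broadcast (fun ξ => do
          return .rreq 0 (← ξ .rreqid) (← ξ .dip) (sqn (← ξ .rt) (← ξ .dip))
            (sqnf (← ξ .rt) (← ξ .dip)) (← ξ .ip) (← ξ .sn) (← ξ .ip)) <|
      callSame .AODV)

/-- Handling of a newly injected data packet. -/
def bodyNEWPKT : SP IP DATA :=
  .choice
    (.guard ⟨{.dip, .ip}, fun ξ => truth do return (← ξ .dip) = (← ξ .ip)⟩ <|
      .deliver (fun ξ => ξ .data) <| callSame .AODV)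
    (.guard ⟨{.dip, .ip}, fun ξ => truth do return (← ξ .dip) ≠ (← ξ .ip)⟩ <|
      .assign .store (fun ξ => do return add (← ξ .data) (← ξ .dip) (← ξ .store)) <|
      callSame .AODV)

/-- Handling of a received data packet. -/
def bodyPKT : SP IP DATA :=
  .choice
    (.guard ⟨{.dip, .ip}, fun ξ => truth do return (← ξ .dip) = (← ξ .ip)⟩ <|
      .deliver (fun ξ => ξ .data) <| callSame .AODV)
    (.guard ⟨{.dip, .ip}, fun ξ => truth do return (← ξ .dip) ≠ (← ξ .ip)⟩ <|
      .choice
        -- a valid route to `dip` is known: forward the packet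
        (.guard ⟨{.dip, .rt}, fun ξ => truth do return (← ξ .dip) ∈ vD (← ξ .rt)⟩ <|
          .unicast (fun ξ => do nhop (← ξ .rt) (← ξ .dip))
            (fun ξ => do return .pkt (← ξ .data) (← ξ .dip) (← ξ .oip))
            (callSame .AODV)
            (linkBreak fun ξ => ξ .dip))
        -- no valid route to `dip` is known
        (.guard ⟨{.dip, .rt}, fun ξ => truth do return (← ξ .dip) ∉ vD (← ξ .rt)⟩ <|
          .choice
            (.guard ⟨{.dip, .rt}, fun ξ => truth do return (← ξ .dip) ∈ iD (← ξ .rt)⟩ <|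
              .groupcast (fun ξ => do precs (← ξ .rt) (← ξ .dip))
                (fun ξ => do
                  return .rerr (singleDest (← ξ .dip) (sqn (← ξ .rt) (← ξ .dip))) (← ξ .ip)) <|
              callSame .AODV)
            (.guard ⟨{.dip, .rt}, fun ξ => truth do return (← ξ .dip) ∉ iD (← ξ .rt)⟩ <|
              callSame .AODV)))

/-- Handling of a route request. -/
def bodyRREQ : SP IP DATA :=
  .choice
    -- the request has been handled before
    (.guard ⟨{.oip, .rreqid, .rreqs}, fun ξ => truth do
        return (← ξ .oip, ← ξ .rreqid) ∈ (← ξ .rreqs)⟩ <|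
      callSame .AODV)
    -- the request is new to this node
    (.guard ⟨{.oip, .rreqid, .rreqs}, fun ξ => truth do
        return (← ξ .oip, ← ξ .rreqid) ∉ (← ξ .rreqs)⟩ <|
      .assign .rt (fun ξ => do
        update (← ξ .rt) (← ξ .oip) ⟨← ξ .osn, .kno, .val, (← ξ .hops) + 1, ← ξ .sip, ∅⟩) <|
      .assign .rreqs (fun ξ => do return (← ξ .rreqs) ∪ {(← ξ .oip, ← ξ .rreqid)}) <|
      .choice
        -- this node is the destination: generate a route reply
        (.guard ⟨{.dip, .ip}, fun ξ => truth do return (← ξ .dip) = (← ξ .ip)⟩ <|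
          .assign .sn (fun ξ => do return max (← ξ .sn) (← ξ .dsn)) <|
          .unicast (fun ξ => do nhop (← ξ .rt) (← ξ .oip))
            (fun ξ => do return .rrep 0 (← ξ .dip) (← ξ .sn) (← ξ .oip) (← ξ .ip))
            (callSame .AODV)
            (linkBreak fun ξ => ξ .oip))
        (.guard ⟨{.dip, .ip}, fun ξ => truth do return (← ξ .dip) ≠ (← ξ .ip)⟩ <|
          .choice
            -- a valid, fresh enough route to `dip` is known: generate a route reply
            (.guard ⟨{.dip, .rt, .dsn}, fun ξ => truth do
                return (← ξ .dip) ∈ vD (← ξ .rt) ∧ (← ξ .dsn) ≤ sqn (← ξ .rt) (← ξ .dip) ∧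
                  sqnf (← ξ .rt) (← ξ .dip) = .kno⟩ <|
              .assign .rt (fun ξ => do addpreRT (← ξ .rt) (← ξ .dip) {← ξ .sip}) <|
              .assign .rt (fun ξ => do
                addpreRT (← ξ .rt) (← ξ .oip) {← nhop (← ξ .rt) (← ξ .dip)}) <|
              .unicast (fun ξ => do nhop (← ξ .rt) (← ξ .oip))
                (fun ξ => do
                  return .rrep (← dhops (← ξ .rt) (← ξ .dip)) (← ξ .dip)
                    (sqn (← ξ .rt) (← ξ .dip)) (← ξ .oip) (← ξ .ip))
                (callSame .AODV)
                (linkBreak fun ξ => ξ .oip))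
            -- otherwise: forward the route request
            (.guard ⟨{.dip, .rt, .dsn}, fun ξ => truth do
                return (← ξ .dip) ∉ vD (← ξ .rt) ∨ sqn (← ξ .rt) (← ξ .dip) < (← ξ .dsn) ∨
                  sqnf (← ξ .rt) (← ξ .dip) = .unk⟩ <|
              .broadcast (fun ξ => do
                  return .rreq ((← ξ .hops) + 1) (← ξ .rreqid) (← ξ .dip)
                    (max (sqn (← ξ .rt) (← ξ .dip)) (← ξ .dsn)) (← ξ .dsk) (← ξ .oip) (← ξ .osn)
                    (← ξ .ip)) <|
              callSame .AODV)))

/-- The routing table that results from a received route reply. -/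
def rrepUpdate : Exp IP DATA (RT IP) := fun ξ => do
  update (← ξ .rt) (← ξ .dip) ⟨← ξ .dsn, .kno, .val, (← ξ .hops) + 1, ← ξ .sip, ∅⟩

/-- Handling of a route reply. -/
def bodyRREP : SP IP DATA :=
  .choice
    -- the reply contains new information
    (.guard ⟨{.rt, .dip, .dsn, .hops, .sip}, fun ξ => truth do
        return (← ξ .rt) ≠ (← rrepUpdate ξ)⟩ <|
      .assign .rt rrepUpdate <|
      .choice
        (.guard ⟨{.oip, .ip}, fun ξ => truth do return (← ξ .oip) = (← ξ .ip)⟩ <|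
          callSame .AODV)
        (.guard ⟨{.oip, .ip}, fun ξ => truth do return (← ξ .oip) ≠ (← ξ .ip)⟩ <|
          .choice
            -- forward the route reply
            (.guard ⟨{.oip, .rt}, fun ξ => truth do return (← ξ .oip) ∈ vD (← ξ .rt)⟩ <|
              .assign .rt (fun ξ => do
                addpreRT (← ξ .rt) (← ξ .dip) {← nhop (← ξ .rt) (← ξ .oip)}) <|
              .assign .rt (fun ξ => do
                addpreRT (← ξ .rt) (← nhop (← ξ .rt) (← ξ .dip)) {← nhop (← ξ .rt) (← ξ .oip)}) <|
              .unicast (fun ξ => do nhop (← ξ .rt) (← ξ .oip))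
                (fun ξ => do
                  return .rrep ((← ξ .hops) + 1) (← ξ .dip) (← ξ .dsn) (← ξ .oip) (← ξ .ip))
                (callSame .AODV)
                (linkBreak fun ξ => ξ .oip))
            (.guard ⟨{.oip, .rt}, fun ξ => truth do return (← ξ .oip) ∉ vD (← ξ .rt)⟩ <|
              callSame .AODV)))
    -- the reply contains no new information and is dropped
    (.guard ⟨{.rt, .dip, .dsn, .hops, .sip}, fun ξ => truth do
        return (← ξ .rt) = (← rrepUpdate ξ)⟩ <|
      callSame .AODV)

/-- Handling of a route error. -/
def bodyRERR : SP IP DATA :=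
  .assign .dests (fun ξ => do return affectedDests (← ξ .rt) (← ξ .dests) (← ξ .sip)) reportDests

/-- The message queue. -/
def bodyQMSG : SP IP DATA :=
  .choice
    (.receive <| callQmsg fun ξ => do return (← ξ .msgs) ++ [← ξ .msg])
    (.guard ⟨{.msgs}, fun ξ => truth do return (← ξ .msgs) ≠ []⟩ <|
      .choice
        (.send (fun ξ => do (← ξ .msgs).head?) <|
          callQmsg fun ξ => do (← ξ .msgs).tail?)
        (.receive <| callQmsg fun ξ => do return (← ξ .msgs) ++ [← ξ .msg]))

/-- The right-hand sides of the defining equations of the process names. -/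
def body : PName → SP IP DATA
  | .AODV => bodyAODV
  | .NEWPKT => bodyNEWPKT
  | .PKT => bodyPKT
  | .RREQ => bodyRREQ
  | .RREP => bodyRREP
  | .RERR => bodyRERR
  | .QMSG => bodyQMSG

end Specification

/-! ## Structural operational semantics -/

/-- Actions of sequential processes; `notUnicast` is a failed unicast. -/
inductive SAct (IP DATA : Type)
  | broadcast (m : Msg IP DATA)
  | groupcast (D : Set IP) (m : Msg IP DATA)
  | unicast (dip : IP) (m : Msg IP DATA)
  | notUnicast (dip : IP) (m : Msg IP DATA)
  | send (m : Msg IP DATA)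
  | deliver (d : DATA)
  | receive (m : Msg IP DATA)
  | tau

section Semantics
variable {IP DATA : Type}

/-- `φ.Sat ξ ζ`: the valuation `ζ` extends `ξ` by values for exactly those free variables of `φ`
that `ξ` does not evaluate, in such a way that `φ` holds. -/
def Formula.Sat (φ : Formula IP DATA) (ξ ζ : Valuation IP DATA) : Prop :=
  (∀ v, (ξ v).isSome → ζ v = ξ v) ∧ (∀ v, (ζ v).isSome ↔ (ξ v).isSome ∨ v ∈ φ.free) ∧ φ.holds ζ

/-- The valuation of exactly the formal parameters of `X`, with the arguments evaluated in `ξ`. -/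
def callVal (X : PName) (args : (v : Var) → Exp IP DATA (Ty IP DATA v)) (ξ : Valuation IP DATA) :
    Valuation IP DATA := fun v => if v ∈ params X then args v ξ else none

/-- Transitions of sequential processes. -/
inductive SStep : Valuation IP DATA → SP IP DATA → SAct IP DATA →
    Valuation IP DATA → SP IP DATA → Prop
  | broadcast {ξ ms p m} (h : ms ξ = some m) : SStep ξ (.broadcast ms p) (.broadcast m) ξ p
  | groupcast {ξ dests ms p D m} (hD : dests ξ = some D) (h : ms ξ = some m) :
      SStep ξ (.groupcast dests ms p) (.groupcast D m) ξ p
  | unicast {ξ dest ms p q dip m} (hd : dest ξ = some dip) (h : ms ξ = some m) :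
      SStep ξ (.unicast dest ms p q) (.unicast dip m) ξ p
  | notUnicast {ξ dest ms p q dip m} (hd : dest ξ = some dip) (h : ms ξ = some m) :
      SStep ξ (.unicast dest ms p q) (.notUnicast dip m) ξ q
  | send {ξ ms p m} (h : ms ξ = some m) : SStep ξ (.send ms p) (.send m) ξ p
  | deliver {ξ data p d} (h : data ξ = some d) : SStep ξ (.deliver data p) (.deliver d) ξ p
  | receive {ξ p} (m) :
      SStep ξ (.receive p) (.receive m) (Function.update ξ .msg (some m)) p
  | assign {ξ v e p x} (h : e ξ = some x) :
      SStep ξ (.assign v e p) .tau (Function.update ξ v (some x)) p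
  | call {ξ X args a ζ p'} (hargs : ∀ v ∈ params X, (args v ξ).isSome)
      (h : SStep (callVal X args ξ) (body X) a ζ p') : SStep ξ (.call X args) a ζ p'
  | choiceL {ξ p q a ζ p'} (h : SStep ξ p a ζ p') : SStep ξ (.choice p q) a ζ p'
  | choiceR {ξ p q a ζ q'} (h : SStep ξ q a ζ q') : SStep ξ (.choice p q) a ζ q'
  | guard {ξ φ p ζ} (h : φ.Sat ξ ζ) : SStep ξ (.guard φ p) .tau ζ p

/-- Given the transitions that leave a state `s`, a transition (`some`) or no transition (`none`)
from `s` to `s'`. -/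
def OptStep {S L : Type} (step : L → S → Prop) (s : S) : Option L → S → Prop
  | some a, s' => step a s'
  | none, s' => s' = s

/-- Parallel process expressions: `seq ξ p` is a sequential process with its valuation, and
`par P Q` the parallel composition with information flowing from `Q` to `P`. -/
inductive PP (IP DATA : Type)
  | seq (ξ : Valuation IP DATA) (p : SP IP DATA)
  | par (P Q : PP IP DATA)

/-- Labels of transitions of parallel processes: the action, together with the set of all actions of
sequential processes that occur in the derivation of the transition. -/
abbrev PLab (IP DATA : Type) := SAct IP DATA × Set (SAct IP DATA)

/-- `ParRule x y ℓ`: a transition labelled `ℓ` of `par P Q` is derived from the transition `x` of `P`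
and the transition `y` of `Q`, where `none` means that the component does not participate. -/
inductive ParRule : Option (PLab IP DATA) → Option (PLab IP DATA) → PLab IP DATA → Prop
  | left {a D} (h : ∀ m, a ≠ .receive m) : ParRule (some (a, D)) none (a, D)
  | right {a D} (h : ∀ m, a ≠ .send m) : ParRule none (some (a, D)) (a, D)
  | sync {m D E} : ParRule (some (.receive m, D)) (some (.send m, E)) (.tau, D ∪ E)

/-- Transitions of parallel processes. -/
def PStep : PP IP DATA → PLab IP DATA → PP IP DATA → Prop
  | .seq ξ p, ℓ, T => ∃ a ζ p', SStep ξ p a ζ p' ∧ ℓ = (a, {a}) ∧ T = .seq ζ p'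
  | .par P Q, ℓ, T => ∃ x y P' Q', ParRule x y ℓ ∧ T = .par P' Q' ∧
      OptStep (PStep P) P x P' ∧ OptStep (PStep Q) Q y Q'

/-- Partial network expressions: nodes `ip : P : R` and parallel compositions. The network expression
`[M]` is represented by `M`; its transitions are given by `NStep` below. -/
inductive Net (IP DATA : Type)
  | node (ip : IP) (P : PP IP DATA) (R : Set IP)
  | par (M N : Net IP DATA)

/-- Actions of nodes and partial networks. -/
inductive MAct (IP DATA : Type)
  | starcast (R : Set IP) (m : Msg IP DATA)
  | arrive (H K : Set IP) (m : Msg IP DATA)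
  | connect (ip ip' : IP)
  | disconnect (ip ip' : IP)
  | deliver (ip : IP) (d : DATA)
  | tau

/-- Actions of (encapsulated) networks. -/
inductive NAct (IP DATA : Type)
  | connect (ip ip' : IP)
  | disconnect (ip ip' : IP)
  | newpkt (ip : IP) (d : DATA) (dip : IP)
  | deliver (ip : IP) (d : DATA)
  | tau

/-- The actions of sequential processes that occur in the derivation of a transition, each with the
address of the node that performs it. -/
abbrev Deriv (IP DATA : Type) := Set (IP × SAct IP DATA)

/-- Labels of transitions of nodes and partial networks. -/
abbrev MLab (IP DATA : Type) := MAct IP DATA × Deriv IP DATA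

/-- Labels of transitions of networks. -/
abbrev NLab (IP DATA : Type) := NAct IP DATA × Deriv IP DATA

/-- Annotates actions with the address of the node. -/
def tag (ip : IP) (D : Set (SAct IP DATA)) : Deriv IP DATA := {x | x.1 = ip ∧ x.2 ∈ D}

/-- `NodeRule ip R x ℓ R'`: a transition labelled `ℓ` of the node `ip : P : R` with resulting range
`R'` is derived from the transition `x` of `P`, where `none` means that `P` does not participate. -/
inductive NodeRule (ip : IP) (R : Set IP) :
    Option (PLab IP DATA) → MLab IP DATA → Set IP → Prop
  | broadcast {m D} : NodeRule ip R (some (.broadcast m, D)) (.starcast R m, tag ip D) R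
  | groupcast {T m D} : NodeRule ip R (some (.groupcast T m, D)) (.starcast (R ∩ T) m, tag ip D) R
  | unicast {dip m D} (h : dip ∈ R) :
      NodeRule ip R (some (.unicast dip m, D)) (.starcast {dip} m, tag ip D) R
  | notUnicast {dip m D} (h : dip ∉ R) :
      NodeRule ip R (some (.notUnicast dip m, D)) (.tau, tag ip D) R
  | deliver {d D} : NodeRule ip R (some (.deliver d, D)) (.deliver ip d, tag ip D) R
  | receive {m D} : NodeRule ip R (some (.receive m, D)) (.arrive {ip} ∅ m, tag ip D) R
  | tau {D} : NodeRule ip R (some (.tau, D)) (.tau, tag ip D) R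
  | notArrive {m} : NodeRule ip R none (.arrive ∅ {ip} m, ∅) R
  | connectL {ip'} : NodeRule ip R none (.connect ip ip', ∅) (R ∪ {ip'})
  | connectR {ip'} : NodeRule ip R none (.connect ip' ip, ∅) (R ∪ {ip'})
  | connectOther {ip' ip''} (h : ip ≠ ip' ∧ ip ≠ ip'') :
      NodeRule ip R none (.connect ip' ip'', ∅) R
  | disconnectL {ip'} : NodeRule ip R none (.disconnect ip ip', ∅) (R \ {ip'})
  | disconnectR {ip'} : NodeRule ip R none (.disconnect ip' ip, ∅) (R \ {ip'})
  | disconnectOther {ip' ip''} (h : ip ≠ ip' ∧ ip ≠ ip'') :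
      NodeRule ip R none (.disconnect ip' ip'', ∅) R

/-- `NetRule x y ℓ`: a transition labelled `ℓ` of the partial network `par M N` is derived from the
transition `x` of `M` and the transition `y` of `N`. -/
inductive NetRule : Option (MLab IP DATA) → Option (MLab IP DATA) → MLab IP DATA → Prop
  | castL {R H K m D E} (hH : H ⊆ R) (hK : K ∩ R = ∅) :
      NetRule (some (.starcast R m, D)) (some (.arrive H K m, E)) (.starcast R m, D ∪ E)
  | castR {R H K m D E} (hH : H ⊆ R) (hK : K ∩ R = ∅) :
      NetRule (some (.arrive H K m, D)) (some (.starcast R m, E)) (.starcast R m, D ∪ E)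
  | arrive {H K H' K' m D E} :
      NetRule (some (.arrive H K m, D)) (some (.arrive H' K' m, E))
        (.arrive (H ∪ H') (K ∪ K') m, D ∪ E)
  | deliverL {ip d D} : NetRule (some (.deliver ip d, D)) none (.deliver ip d, D)
  | deliverR {ip d D} : NetRule none (some (.deliver ip d, D)) (.deliver ip d, D)
  | tauL {D} : NetRule (some (.tau, D)) none (.tau, D)
  | tauR {D} : NetRule none (some (.tau, D)) (.tau, D)
  | connect {ip ip' D E} :
      NetRule (some (.connect ip ip', D)) (some (.connect ip ip', E)) (.connect ip ip', D ∪ E)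
  | disconnect {ip ip' D E} :
      NetRule (some (.disconnect ip ip', D)) (some (.disconnect ip ip', E))
        (.disconnect ip ip', D ∪ E)

/-- Transitions of partial networks. -/
def MStep : Net IP DATA → MLab IP DATA → Net IP DATA → Prop
  | .node ip P R, ℓ, T => ∃ x P' R', NodeRule ip R x ℓ R' ∧ T = .node ip P' R' ∧
      OptStep (PStep P) P x P'
  | .par M N, ℓ, T => ∃ x y M' N', NetRule x y ℓ ∧ T = .par M' N' ∧
      OptStep (MStep M) M x M' ∧ OptStep (MStep N) N y N'

/-- `EncRule x ℓ`: a transition labelled `ℓ` of `[M]` is derived from the transition `x` of `M`. -/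
inductive EncRule : MLab IP DATA → NLab IP DATA → Prop
  | connect {ip ip' D} : EncRule (.connect ip ip', D) (.connect ip ip', D)
  | disconnect {ip ip' D} : EncRule (.disconnect ip ip', D) (.disconnect ip ip', D)
  | starcast {R m D} : EncRule (.starcast R m, D) (.tau, D)
  | tau {D} : EncRule (.tau, D) (.tau, D)
  | deliver {ip d D} : EncRule (.deliver ip d, D) (.deliver ip d, D)
  | newpkt {ip K d dip D} : EncRule (.arrive {ip} K (.newpkt d dip), D) (.newpkt ip d dip, D)

/-- Transitions of the network `[M]`. -/
def NStep (M : Net IP DATA) (ℓ : NLab IP DATA) (M' : Net IP DATA) : Prop :=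
  ∃ x, EncRule x ℓ ∧ MStep M x M'

/-! ## Paths and complete paths -/

/-- A sequence of states and optional transition labels. It represents the path obtained by leaving
out all steps without a transition (label `none`); this path may be finite or infinite. Keeping the
idle steps keeps the paths of the components of a system aligned in time. -/
structure Run (S L : Type) where
  state : ℕ → S
  lab : ℕ → Option L

namespace Run
variable {S L : Type}

/-- Each step of the run is a transition or idle. -/
def IsRun (step : S → L → S → Prop) (π : Run S L) : Prop :=
  ∀ n, OptStep (step (π.state n)) (π.state n) (π.lab n) (π.state (n + 1))

/-- The path is finite, and from its last state an internal or output transition is possible. -/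
def EndsPrematurely (step : S → L → S → Prop) (out : L → Prop) (π : Run S L) : Prop :=
  ∃ n, (∀ m ≥ n, π.lab m = none) ∧ ∃ a s, out a ∧ step (π.state n) a s

end Run

/-- Internal and output actions of sequential and parallel processes. -/
def SAct.IsOut : SAct IP DATA → Prop
  | .send _ => False
  | .receive _ => False
  | _ => True

/-- Internal and output actions of nodes and partial networks. -/
def MAct.IsOut : MAct IP DATA → Prop
  | .starcast _ _ => True
  | .deliver _ _ => True
  | .tau => True
  | _ => False

/-- Internal and output actions of networks. -/
def NAct.IsOut : NAct IP DATA → Prop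
  | .deliver _ _ => True
  | .tau => True
  | _ => False

/-- Complete paths of sequential and parallel processes. -/
inductive PComplete : Run (PP IP DATA) (PLab IP DATA) → Prop
  | seq {π : Run (PP IP DATA) (PLab IP DATA)}
      (hrun : π.IsRun PStep) (hend : ¬ π.EndsPrematurely PStep (fun ℓ => ℓ.1.IsOut))
      (hseq : ∀ n, ∃ ξ p, π.state n = .seq ξ p) : PComplete π
  | par {π π₁ π₂ : Run (PP IP DATA) (PLab IP DATA)}
      (hrun : π.IsRun PStep) (hend : ¬ π.EndsPrematurely PStep (fun ℓ => ℓ.1.IsOut))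
      (hstate : ∀ n, π.state n = .par (π₁.state n) (π₂.state n))
      (hlab : ∀ n, match π.lab n with
        | some ℓ => ParRule (π₁.lab n) (π₂.lab n) ℓ
        | none => π₁.lab n = none ∧ π₂.lab n = none)
      (h₁ : PComplete π₁) (h₂ : PComplete π₂) : PComplete π

/-- Complete paths of nodes and partial networks. -/
inductive MComplete : Run (Net IP DATA) (MLab IP DATA) → Prop
  | node {π : Run (Net IP DATA) (MLab IP DATA)} {ip : IP} {ρ : Run (PP IP DATA) (PLab IP DATA)}
      {R : ℕ → Set IP}
      (hrun : π.IsRun MStep) (hend : ¬ π.EndsPrematurely MStep (fun ℓ => ℓ.1.IsOut))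
      (hstate : ∀ n, π.state n = .node ip (ρ.state n) (R n))
      (hlab : ∀ n, match π.lab n with
        | some ℓ => NodeRule ip (R n) (ρ.lab n) ℓ (R (n + 1))
        | none => ρ.lab n = none)
      (h : PComplete ρ) : MComplete π
  | par {π π₁ π₂ : Run (Net IP DATA) (MLab IP DATA)}
      (hrun : π.IsRun MStep) (hend : ¬ π.EndsPrematurely MStep (fun ℓ => ℓ.1.IsOut))
      (hstate : ∀ n, π.state n = .par (π₁.state n) (π₂.state n))
      (hlab : ∀ n, match π.lab n with
        | some ℓ => NetRule (π₁.lab n) (π₂.lab n) ℓ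
        | none => π₁.lab n = none ∧ π₂.lab n = none)
      (h₁ : MComplete π₁) (h₂ : MComplete π₂) : MComplete π

/-- Complete paths of networks. Such a path has no idle steps, except for an infinite idle tail in
case it is finite. -/
def NComplete (π : Run (Net IP DATA) (NLab IP DATA)) : Prop :=
  π.IsRun NStep ∧ (∀ n, π.lab n = none → π.lab (n + 1) = none) ∧
  ¬ π.EndsPrematurely NStep (fun ℓ => ℓ.1.IsOut) ∧
  ∃ ρ : Run (Net IP DATA) (MLab IP DATA), MComplete ρ ∧ (∀ n, π.state n = ρ.state n) ∧
    ∀ n, match π.lab n with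
      | some ℓ => ∃ x, ρ.lab n = some x ∧ EncRule x ℓ
      | none => ρ.lab n = none

/-! ## Linear-time temporal logic -/

variable (IP DATA) in
/-- LTL formulas over predicates on states and predicates on transitions. -/
inductive LTL
  | state (φ : Net IP DATA → Prop)
  | trans (φ : NLab IP DATA → Prop)
  | neg (φ : LTL)
  | and (φ ψ : LTL)
  | or (φ ψ : LTL)
  | imp (φ ψ : LTL)
  | G (φ : LTL)
  | F (φ : LTL)

/-- Truth of a formula on the remainder of a path from position `k` onwards. Each transition is split
in two by a new state halfway: position `2 * n` is the `n`-th state of the path, and position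
`2 * n + 1` lies halfway the transition from the `n`-th to the next state. A state predicate holds
there if it holds in the next state. (As there is no next-state operator, the infinite repetition
of the last state of a finite path makes no difference.) -/
def LTL.Holds (π : Run (Net IP DATA) (NLab IP DATA)) : LTL IP DATA → ℕ → Prop
  | .state φ, k => φ (π.state ((k + 1) / 2))
  | .trans φ, k => k % 2 = 1 ∧ ∃ ℓ, π.lab (k / 2) = some ℓ ∧ φ ℓ
  | .neg φ, k => ¬ φ.Holds π k
  | .and φ ψ, k => φ.Holds π k ∧ ψ.Holds π k
  | .or φ ψ, k => φ.Holds π k ∨ ψ.Holds π k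
  | .imp φ ψ, k => φ.Holds π k → ψ.Holds π k
  | .G φ, k => ∀ j ≥ k, φ.Holds π j
  | .F φ, k => ∃ j ≥ k, φ.Holds π j

/-! ## Atomic propositions -/

/-- `ip : P : R` is one of the node expressions of the network. -/
def Net.HasNode : Net IP DATA → IP → PP IP DATA → Set IP → Prop
  | .node ip P R, ip', P', R' => ip = ip' ∧ P = P' ∧ R = R'
  | .par M N, ip', P', R' => M.HasNode ip' P' R' ∨ N.HasNode ip' P' R'

/-- The addresses of the nodes of a network. -/
def Net.addrs : Net IP DATA → List IP
  | .node ip _ _ => [ip]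
  | .par M N => M.addrs ++ N.addrs

/-- `ξ` is the current valuation of the main process of node `ip`. -/
def Net.MainVal (M : Net IP DATA) (ip : IP) (ξ : Valuation IP DATA) : Prop :=
  ∃ p Q R, M.HasNode ip (.par (.seq ξ p) Q) R

/-- `ζ` is the current valuation of the message queue of node `ip`. -/
def Net.QueueVal (M : Net IP DATA) (ip : IP) (ζ : Valuation IP DATA) : Prop :=
  ∃ P q R, M.HasNode ip (.par P (.seq ζ q)) R

/-- `store` and `rt` are the current store and the current routing table of node `ip`. -/
def Net.StoreRT (M : Net IP DATA) (ip : IP) (store : Store IP DATA) (rt : RT IP) : Prop :=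
  ∃ ξ, M.MainVal ip ξ ∧ ξ .store = some store ∧ ξ .rt = some rt

/-- Node `ip` has queued packets for `dip` and a valid route to `dip`. -/
def queuedWithRoute (ip dip : IP) : LTL IP DATA :=
  .state fun M => ∃ store rt, M.StoreRT ip store rt ∧ dip ∈ qD store ∩ vD rt

/-- Node `ip` has queued packets for `dip` but no valid route to `dip`. -/
def queuedNoRoute (ip dip : IP) : LTL IP DATA :=
  .state fun M => ∃ store rt, M.StoreRT ip store rt ∧ dip ∈ qD store \ vD rt

/-- The request-required flag at node `ip` for `dip` is set to `req`. -/
def flagReq (ip dip : IP) : LTL IP DATA :=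
  .state fun M => ∃ store rt, M.StoreRT ip store rt ∧ qflag store dip = some .req

/-- The message queue of node `ip` is not empty. -/
def msgsNonempty (ip : IP) : LTL IP DATA :=
  .state fun M => ∃ ζ ms, M.QueueVal ip ζ ∧ ζ .msgs = some ms ∧ ms ≠ []

/-- There is a chain of nodes, each in range of the preceding one, from `oip` to `dip`. -/
def connectedStar (oip dip : IP) : LTL IP DATA :=
  .state fun M => Relation.ReflTransGen (fun x y => ∃ P R, M.HasNode x P R ∧ y ∈ R) oip dip

/-- Node `ip` tries to unicast a data packet with origin `ip` and destination `dip`. -/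
def unicastsPkt (ip dip : IP) : LTL IP DATA :=
  .trans fun ℓ => ∃ nh d, (ip, SAct.unicast nh (.pkt d dip ip)) ∈ ℓ.2 ∨
    (ip, SAct.notUnicast nh (.pkt d dip ip)) ∈ ℓ.2

/-- Node `ip` broadcasts a new request for a route from `ip` to `dip`. -/
def broadcastsRreq (ip dip : IP) : LTL IP DATA :=
  .trans fun ℓ => ∃ hops rreqid dsn dsk osn,
    (ip, SAct.broadcast (.rreq hops rreqid dip dsn dsk ip osn ip)) ∈ ℓ.2

/-- The message queue of node `ip` performs a send-action. -/
def sends (ip : IP) : LTL IP DATA := .trans fun ℓ => ∃ m, (ip, SAct.send m) ∈ ℓ.2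

/-- A client injects the data packet `d` with destination `dip` at node `oip`. -/
def injects (oip : IP) (d : DATA) (dip : IP) : LTL IP DATA :=
  .trans fun ℓ => ℓ.1 = .newpkt oip d dip

/-- The data packet `d` is delivered at node `dip`. -/
def delivers (dip : IP) (d : DATA) : LTL IP DATA := .trans fun ℓ => ℓ.1 = .deliver dip d

/-- Some two nodes get disconnected. -/
def disconnects : LTL IP DATA := .trans fun ℓ => ∃ ip ip', ℓ.1 = .disconnect ip ip'

/-! ## The AODV specification and packet delivery -/

/-- The fairness property for sending queued data packets. -/
def fair₁ (ip dip : IP) : LTL IP DATA := .G (.imp (.G (queuedWithRoute ip dip)) (.F (unicastsPkt ip dip)))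

/-- The fairness property for initiating route discoveries. -/
def fair₂ (ip dip : IP) : LTL IP DATA :=
  .G (.imp (.G (.and (queuedNoRoute ip dip) (flagReq ip dip))) (.F (broadcastsRreq ip dip)))

/-- The fairness property for handling queued messages. -/
def fair₃ (ip : IP) : LTL IP DATA := .G (.imp (.G (msgsNonempty ip)) (.F (sends ip)))

/-- The initial valuation of the main process of node `ip`. -/
def initMain (ip : IP) : Valuation IP DATA
  | .ip => some ip
  | .sn => some (1 : ℕ)
  | .rt => some fun _ => none
  | .rreqs => some ∅
  | .store => some fun _ => none
  | _ => none

/-- The initial valuation of the message queue. -/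
def initQueue : Valuation IP DATA
  | .msgs => some []
  | _ => none

/-- The initial process of node `ip`: the basic routine in parallel with the message queue. -/
def initProc (ip : IP) : PP IP DATA :=
  .par (.seq (initMain ip) (callSame .AODV)) (.seq initQueue (callSame .QMSG))

/-- Initial states: the nodes have distinct addresses and run the initial process; there is a link
between nodes in both directions or not at all, links lead to other nodes of the network only. -/
def Net.IsInitial (M : Net IP DATA) : Prop :=
  M.addrs.Nodup ∧
  (∀ ip P R, M.HasNode ip P R → P = initProc ip ∧ ip ∉ R ∧ ∀ ip' ∈ R, ip' ∈ M.addrs) ∧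
  ∀ ip P R ip' P' R', M.HasNode ip P R → M.HasNode ip' P' R' → (ip' ∈ R ↔ ip ∈ R')

/-- The formula `φ` holds for AODV with initial state `M₀`: it holds for all complete paths from
`M₀` that satisfy the fairness specification. -/
def Satisfies (M₀ : Net IP DATA) (φ : LTL IP DATA) : Prop :=
  ∀ π : Run (Net IP DATA) (NLab IP DATA), π.state 0 = M₀ → NComplete π →
    (∀ ip dip, (fair₁ ip dip).Holds π 0) → (∀ ip dip, (fair₂ ip dip).Holds π 0) →
    (∀ ip, (fair₃ ip).Holds π 0) → φ.Holds π 0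

/-- The packet delivery property for origin `oip`, destination `dip` and data packet `d`. -/
def packetDelivery (oip dip : IP) (d : DATA) : LTL IP DATA :=
  .imp
    (.G (.imp (.G (queuedNoRoute oip dip)) (.F (flagReq oip dip))))
    (.G (.imp (connectedStar oip dip)
      (.F (.or (.or (delivers dip d) disconnects) (.neg (.F (injects oip d dip)))))))

variable (IP DATA) in
/-- AODV satisfies the property packet delivery: in all networks, for all nodes `oip` and `dip` and
all data packets. -/
def SatisfiesPacketDelivery : Prop :=
  ∀ M₀ : Net IP DATA, M₀.IsInitial → ∀ oip ∈ M₀.addrs, ∀ dip ∈ M₀.addrs, ∀ d : DATA,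
    Satisfies M₀ (packetDelivery oip dip d)

end Semantics

end

end AODV

namespace AODV

noncomputable section

/-! ## Networks of three nodes -/

/-! The counterexample lives on a line source – relay – target and exploits the way AODV distributes
precursors: a node that forwards a route reply records precursors for the route to the node that was
searched for, but none for the reverse route to the originator of the request. If this reverse route
breaks, nobody is told.

Let the target search for the source. Its request reaches the queue of the relay, and then the link
between relay and target is removed. The relay, still unaware, installs a valid route to the target
and forwards the request; the source installs a valid route to the target via the relay and replies.
When the relay tries to pass on the reply, the unicast fails and its route to the target is
invalidated. That entry has no precursors, so the error message goes to the empty set. Afterwards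
the link is restored. The result is the situation `Stale`: the source trusts its route via the
relay, while the relay has an invalid route and no one to notify. From then on each packet that the
source sends to the target is silently dropped at the relay, and this changes no routing table.
`exists_path_stale` constructs the path to this situation; its core is `handles_rrep_lost`.

`Stale.reach` is a loop from `Stale` to `Stale`: a packet is injected at the source, sent and lost.
In addition a packet for the source is injected at the target and stored there. This serves only to
let every component act in every round, for then completeness of all component paths is automatic:
the condition on paths that stop is vacuous (`netRun_complete`). `exists_infinite_path` iterates the
loop forever.

The path is fair because `Stale` recurs. In such states no node has a queued packet with a valid
route, and no request-required flag is set (the flag at the target remains `noreq`), so the premises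
of the first two fairness conditions never hold persistently; the third holds since every queue
hands over messages infinitely often. The premise of packet delivery holds because the store of the
source is empty whenever `Stale` holds. Its conclusion fails: source and target are connected, and
the packet is injected again and again, but after the reconnection there is neither a delivery nor a
disconnection. -/

/-- The three nodes of the network: the source and the target of the data packets, and a relay
between them. -/
inductive Role | source | relay | target
  deriving DecidableEq

variable {IP DATA : Type}

/-- Infinitely many transitions rule out an idle tail, so it never has to be determined which
transitions are enabled. All completeness claims below rest on this. -/
theorem Run.not_endsPrematurely {S L : Type} {step : S → L → S → Prop} {out : L → Prop}
    {π : Run S L} (h : ∀ N, ∃ n ≥ N, (π.lab n).isSome) : ¬ π.EndsPrematurely step out := by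
  rintro ⟨N, hN, -⟩
  obtain ⟨n, hn, hs⟩ := h N
  simp [hN n hn] at hs

variable (IP DATA) in
/-- The state of a node: the main process `p` with its valuation `ξ`, the message queue `q` with its
valuation `ζ`, and the transmission range. -/
structure NodeState where
  ξ : Valuation IP DATA
  p : SP IP DATA
  ζ : Valuation IP DATA
  q : SP IP DATA
  R : Set IP

def NodeState.proc (ν : NodeState IP DATA) : PP IP DATA := .par (.seq ν.ξ ν.p) (.seq ν.ζ ν.q)

variable (IP DATA) in
/-- The labels of the simultaneous transitions of the components of a node. -/
structure NodeTick where
  main : Option (PLab IP DATA)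
  queue : Option (PLab IP DATA)
  proc : Option (PLab IP DATA)
  node : Option (MLab IP DATA)

/-- Completeness is recursive: it requires a path for each component, aligned with the path of the
whole. Hence a step keeps the labels at all levels of the node instead of only the outermost one. -/
structure NodeStep (ip : IP) (ν : NodeState IP DATA) (τ : NodeTick IP DATA)
    (ν' : NodeState IP DATA) : Prop where
  main : OptStep (PStep (.seq ν.ξ ν.p)) (.seq ν.ξ ν.p) τ.main (.seq ν'.ξ ν'.p)
  queue : OptStep (PStep (.seq ν.ζ ν.q)) (.seq ν.ζ ν.q) τ.queue (.seq ν'.ζ ν'.q)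
  proc : match τ.proc with
    | some ℓ => ParRule τ.main τ.queue ℓ
    | none => τ.main = none ∧ τ.queue = none
  node : match τ.node with
    | some ℓ => NodeRule ip ν.R τ.proc ℓ ν'.R
    | none => τ.proc = none ∧ ν'.R = ν.R

variable (IP DATA) in
abbrev Config := Role → NodeState IP DATA

/-- The network in which `addr` gives the addresses of the three nodes. -/
def Config.net (addr : Role → IP) (c : Config IP DATA) : Net IP DATA :=
  .par (.node (addr .source) (c .source).proc (c .source).R)
    (.par (.node (addr .relay) (c .relay).proc (c .relay).R)
      (.node (addr .target) (c .target).proc (c .target).R))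

variable (IP DATA) in
/-- The labels of the simultaneous transitions of all components of the network. -/
structure Tick where
  nodes : Role → NodeTick IP DATA
  pair : Option (MLab IP DATA)
  whole : MLab IP DATA
  lab : NLab IP DATA

structure ConfigStep (addr : Role → IP) (c : Config IP DATA) (t : Tick IP DATA)
    (c' : Config IP DATA) : Prop where
  nodes : ∀ i, NodeStep (addr i) (c i) (t.nodes i) (c' i)
  pair : match t.pair with
    | some ℓ => NetRule (t.nodes .relay).node (t.nodes .target).node ℓ
    | none => (t.nodes .relay).node = none ∧ (t.nodes .target).node = none
  whole : NetRule (t.nodes .source).node t.pair t.whole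
  lab : EncRule t.whole t.lab

/-- The queue of node `i` hands a message to the main process. -/
structure Tick.IsSync (addr : Role → IP) (i : Role) (t : Tick IP DATA) : Prop where
  main : (t.nodes i).main.isSome
  queue : (t.nodes i).queue.isSome
  proc : (t.nodes i).proc.isSome
  node : (t.nodes i).node.isSome
  pair : i ≠ .source → t.pair.isSome
  sends : ∃ m, (addr i, SAct.send m) ∈ t.lab.2

/-! ### Complete paths -/

section Complete

variable {addr : Role → IP} {c : ℕ → Config IP DATA} {t : ℕ → Tick IP DATA}

def procRun (c : ℕ → Config IP DATA) (t : ℕ → Tick IP DATA) (i : Role) :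
    Run (PP IP DATA) (PLab IP DATA) := ⟨fun n => (c n i).proc, fun n => ((t n).nodes i).proc⟩

def nodeRun (addr : Role → IP) (c : ℕ → Config IP DATA) (t : ℕ → Tick IP DATA) (i : Role) :
    Run (Net IP DATA) (MLab IP DATA) :=
  ⟨fun n => .node (addr i) (c n i).proc (c n i).R, fun n => ((t n).nodes i).node⟩

def pairRun (addr : Role → IP) (c : ℕ → Config IP DATA) (t : ℕ → Tick IP DATA) :
    Run (Net IP DATA) (MLab IP DATA) :=
  ⟨fun n => .par ((nodeRun addr c t .relay).state n) ((nodeRun addr c t .target).state n),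
    fun n => (t n).pair⟩

def wholeRun (addr : Role → IP) (c : ℕ → Config IP DATA) (t : ℕ → Tick IP DATA) :
    Run (Net IP DATA) (MLab IP DATA) := ⟨fun n => (c n).net addr, fun n => some (t n).whole⟩

def netRun (addr : Role → IP) (c : ℕ → Config IP DATA) (t : ℕ → Tick IP DATA) :
    Run (Net IP DATA) (NLab IP DATA) := ⟨fun n => (c n).net addr, fun n => some (t n).lab⟩

/-- Since main process and queue both act infinitely often, only the step relations have to be
checked; a step that is idle for the node process must be idle for both parts. -/
theorem procRun_complete (h : ∀ n, ConfigStep addr (c n) (t n) (c (n + 1)))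
    (hs : ∀ i N, ∃ n ≥ N, (t n).IsSync addr i) (i : Role) : PComplete (procRun c t i) := by
  refine .par (π₁ := ⟨fun n => .seq (c n i).ξ (c n i).p, fun n => ((t n).nodes i).main⟩)
    (π₂ := ⟨fun n => .seq (c n i).ζ (c n i).q, fun n => ((t n).nodes i).queue⟩)
    (fun n => ?_) (Run.not_endsPrematurely fun N => (hs i N).imp fun n hn => ⟨hn.1, hn.2.proc⟩)
    (fun n => rfl) (fun n => ((h n).nodes i).proc)
    (.seq (fun n => ((h n).nodes i).main)
      (Run.not_endsPrematurely fun N => (hs i N).imp fun n hn => ⟨hn.1, hn.2.main⟩)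
      fun n => ⟨_, _, rfl⟩)
    (.seq (fun n => ((h n).nodes i).queue)
      (Run.not_endsPrematurely fun N => (hs i N).imp fun n hn => ⟨hn.1, hn.2.queue⟩)
      fun n => ⟨_, _, rfl⟩)
  have hn := (h n).nodes i
  have hp := hn.proc
  have hm := hn.main
  have hq := hn.queue
  change OptStep _ _ ((t n).nodes i).proc _
  cases hl : ((t n).nodes i).proc with
  | none =>
    rw [hl] at hp
    simp only [hp.1, hp.2, OptStep] at hm hq
    simp only [PP.seq.injEq] at hm hq
    simp [OptStep, procRun, NodeState.proc, hm, hq]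
  | some ℓ =>
    rw [hl] at hp
    exact ⟨_, _, _, _, hp, rfl, hm, hq⟩

theorem nodeRun_complete (h : ∀ n, ConfigStep addr (c n) (t n) (c (n + 1)))
    (hs : ∀ i N, ∃ n ≥ N, (t n).IsSync addr i) (i : Role) : MComplete (nodeRun addr c t i) := by
  have hP := procRun_complete h hs i
  have hrun : (procRun c t i).IsRun PStep := by cases hP <;> assumption
  refine .node (ρ := procRun c t i) (R := fun n => (c n i).R) (fun n => ?_)
    (Run.not_endsPrematurely fun N => (hs i N).imp fun n hn => ⟨hn.1, hn.2.node⟩)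
    (fun n => rfl) (fun n => ?_) hP
  · have hr := hrun n
    have hn := ((h n).nodes i).node
    change OptStep _ _ ((t n).nodes i).node _
    cases hl : ((t n).nodes i).node with
    | none =>
      rw [hl] at hn
      simp only [procRun, hn.1, OptStep] at hr
      simp [OptStep, nodeRun, hr, hn.2]
    | some ℓ =>
      rw [hl] at hn
      exact ⟨_, _, _, hn, rfl, hr⟩
  · have hn := ((h n).nodes i).node
    simp only [nodeRun]
    split at hn <;> simp_all [procRun]

theorem MComplete.isRun {π : Run (Net IP DATA) (MLab IP DATA)} (h : MComplete π) :
    π.IsRun MStep := by cases h <;> assumption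

theorem pairRun_complete (h : ∀ n, ConfigStep addr (c n) (t n) (c (n + 1)))
    (hs : ∀ i N, ∃ n ≥ N, (t n).IsSync addr i) : MComplete (pairRun addr c t) := by
  have h₁ := nodeRun_complete h hs .relay
  have h₂ := nodeRun_complete h hs .target
  refine .par (fun n => ?_) (Run.not_endsPrematurely fun N =>
    (hs .relay N).imp fun n hn => ⟨hn.1, hn.2.pair (by decide)⟩)
    (fun n => rfl) (fun n => (h n).pair) h₁ h₂
  have hp := (h n).pair
  have hr₁ := h₁.isRun n
  have hr₂ := h₂.isRun n
  change OptStep _ _ (t n).pair _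
  cases hl : (t n).pair with
  | none =>
    rw [hl] at hp
    change OptStep _ _ ((t n).nodes .relay).node _ at hr₁
    change OptStep _ _ ((t n).nodes .target).node _ at hr₂
    rw [hp.1] at hr₁
    rw [hp.2] at hr₂
    simp only [OptStep] at hr₁ hr₂
    simp [OptStep, pairRun, hr₁, hr₂]
  | some ℓ =>
    rw [hl] at hp
    exact ⟨_, _, _, _, hp, rfl, hr₁, hr₂⟩

theorem wholeRun_complete (h : ∀ n, ConfigStep addr (c n) (t n) (c (n + 1)))
    (hs : ∀ i N, ∃ n ≥ N, (t n).IsSync addr i) : MComplete (wholeRun addr c t) := by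
  have h₁ := nodeRun_complete h hs .source
  have h₂ := pairRun_complete h hs
  exact .par (fun n => ⟨_, _, _, _, (h n).whole, rfl, h₁.isRun n, h₂.isRun n⟩)
    (Run.not_endsPrematurely fun N => ⟨N, le_rfl, rfl⟩)
    (fun n => rfl) (π₁ := nodeRun addr c t .source)
    (π₂ := pairRun addr c t) (fun n => (h n).whole) h₁ h₂

/-- The network as a whole is never idle, so the conditions on idle steps and on the end of the path
are vacuous at this level. -/
theorem netRun_complete (h : ∀ n, ConfigStep addr (c n) (t n) (c (n + 1)))
    (hs : ∀ i N, ∃ n ≥ N, (t n).IsSync addr i) : NComplete (netRun addr c t) := by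
  have hw := wholeRun_complete h hs
  exact ⟨fun n => ⟨_, (h n).lab, hw.isRun n⟩, fun n hn => by simp [netRun] at hn,
    Run.not_endsPrematurely fun N => ⟨N, le_rfl, rfl⟩, wholeRun addr c t, hw, fun n => rfl,
    fun n => ⟨_, rfl, (h n).lab⟩⟩

end Complete

/-! ### Single steps -/

namespace NodeStep

variable {ip : IP} {ν : NodeState IP DATA}

theorem idle : NodeStep ip ν ⟨none, none, none, none⟩ ν :=
  ⟨rfl, rfl, ⟨rfl, rfl⟩, rfl, rfl⟩

/-- The main process acts on its own. -/
theorem ofMain {a ξ p ℓ} (h : SStep ν.ξ ν.p a ξ p) (ha : ∀ m, a ≠ .receive m)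
    (hℓ : NodeRule ip ν.R (some (a, {a})) ℓ ν.R) :
    NodeStep ip ν ⟨some (a, {a}), none, some (a, {a}), some ℓ⟩ { ν with ξ := ξ, p := p } :=
  ⟨⟨_, _, _, h, rfl, rfl⟩, rfl, .left ha, hℓ⟩

/-- The message queue acts on its own. -/
theorem ofQueue {a ζ q ℓ} (h : SStep ν.ζ ν.q a ζ q) (ha : ∀ m, a ≠ .send m)
    (hℓ : NodeRule ip ν.R (some (a, {a})) ℓ ν.R) :
    NodeStep ip ν ⟨none, some (a, {a}), some (a, {a}), some ℓ⟩ { ν with ζ := ζ, q := q } :=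
  ⟨rfl, ⟨_, _, _, h, rfl, rfl⟩, .right ha, hℓ⟩

theorem sync {m ξ p ζ q} (h : SStep ν.ξ ν.p (.receive m) ξ p) (h' : SStep ν.ζ ν.q (.send m) ζ q) :
    NodeStep ip ν ⟨some (.receive m, {.receive m}), some (.send m, {.send m}),
      some (.tau, {.receive m} ∪ {.send m}), some (.tau, tag ip ({.receive m} ∪ {.send m}))⟩
      ⟨ξ, p, ζ, q, ν.R⟩ :=
  ⟨⟨_, _, _, h, rfl, rfl⟩, ⟨_, _, _, h', rfl, rfl⟩, .sync, .tau⟩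

/-- Only the environment acts. -/
theorem ofNone {ℓ R} (hℓ : NodeRule ip ν.R none ℓ R) :
    NodeStep ip ν ⟨none, none, none, some ℓ⟩ { ν with R := R } :=
  ⟨rfl, rfl, ⟨rfl, rfl⟩, hℓ⟩

end NodeStep

/-- The node changes from `ν` to `ν'` by the receipt of `m` by its message queue. -/
def Receives (ν : NodeState IP DATA) (m : Msg IP DATA) (ν' : NodeState IP DATA) : Prop :=
  ∃ ζ q, SStep ν.ζ ν.q (.receive m) ζ q ∧ ν' = { ν with ζ := ζ, q := q }

/-- A node takes part in the transmission of `m` to the addresses in `T`. -/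
theorem exists_nodeStep_arrive {ip : IP} {ν ν' : NodeState IP DATA} {T : Set IP} {m : Msg IP DATA}
    (h : ip ∈ T → Receives ν m ν') (h' : ip ∉ T → ν' = ν) :
    ∃ τ H K D, NodeStep ip ν τ ν' ∧ τ.node = some (.arrive H K m, D) ∧ H ⊆ T ∧ K ∩ T = ∅ := by
  by_cases hT : ip ∈ T
  · obtain ⟨ζ, q, hs, rfl⟩ := h hT
    exact ⟨_, _, _, _, .ofQueue hs (by simp) .receive, rfl, by simpa using hT, by simp⟩
  · rw [h' hT]
    exact ⟨_, _, _, _, .ofNone .notArrive, rfl, by simp, by simpa using hT⟩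

/-! ### Steps of the network assembled from steps of its nodes. -/

section Steps

variable {addr : Role → IP} {c : Config IP DATA}

/-- Deliveries and disconnections are the events that could fulfil the conclusion of packet
delivery; the loop has to avoid them. -/
def Tick.Safe (t : Tick IP DATA) : Prop :=
  (∀ ip d, t.lab.1 ≠ .deliver ip d) ∧ ∀ ip ip', t.lab.1 ≠ .disconnect ip ip'

theorem configStep_tau {i : Role} {τ : NodeTick IP DATA} {ν' D}
    (h : NodeStep (addr i) (c i) τ ν') (hτ : τ.node = some (.tau, D)) :
    ∃ t, ConfigStep addr c t (Function.update c i ν') ∧ t.lab = (.tau, D) ∧ t.nodes i = τ ∧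
      (i ≠ .source → t.pair.isSome) := by
  have key : ∀ j, NodeStep (addr j) (c j)
      (Function.update (β := fun _ => NodeTick IP DATA) (fun _ => ⟨none, none, none, none⟩) i τ j)
      (Function.update c i ν' j) := by
    intro j
    by_cases hj : j = i
    · subst hj; simpa using h
    · simpa [hj] using .idle
  refine ⟨⟨Function.update (fun _ => ⟨none, none, none, none⟩) i τ,
    if i = .source then none else some (.tau, D), (.tau, D), (.tau, D)⟩,
    ⟨key, ?_, ?_, .tau⟩, rfl, by simp, fun hi => by simp [hi]⟩
  · cases i <;> simp [hτ, Function.update] <;> constructor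
  · cases i <;> simp [hτ, Function.update] <;> constructor

theorem configStep_starcast {i : Role} {τ : NodeTick IP DATA} {c' T m D}
    (h : NodeStep (addr i) (c i) τ (c' i)) (hτ : τ.node = some (.starcast T m, D))
    (hr : ∀ j ≠ i, (addr j ∈ T → Receives (c j) m (c' j)) ∧ (addr j ∉ T → c' j = c j)) :
    ∃ t, ConfigStep addr c t c' ∧ t.lab.1 = .tau := by
  have key : ∀ j, ∃ τ', NodeStep (addr j) (c j) τ' (c' j) ∧ (j = i → τ' = τ) ∧ (j ≠ i →
      ∃ H K D, τ'.node = some (.arrive H K m, D) ∧ H ⊆ T ∧ K ∩ T = ∅) := by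
    intro j
    by_cases hj : j = i
    · subst hj; exact ⟨τ, h, fun _ => rfl, fun h => absurd rfl h⟩
    · obtain ⟨τ', H, K, D, h₁, h₂, h₃, h₄⟩ :=
        exists_nodeStep_arrive (hr j hj).1 (hr j hj).2
      exact ⟨τ', h₁, fun h => absurd h hj, fun _ => ⟨H, K, D, h₂, h₃, h₄⟩⟩
  choose σ h₁ h₂ h₃ using key
  have hi : (σ i).node = some (.starcast T m, D) := by rw [h₂ i rfl, hτ]
  cases i with
  | source =>
    obtain ⟨H₁, K₁, D₁, e₁, a₁, b₁⟩ := h₃ .relay (by decide)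
    obtain ⟨H₂, K₂, D₂, e₂, a₂, b₂⟩ := h₃ .target (by decide)
    refine ⟨⟨σ, some (.arrive (H₁ ∪ H₂) (K₁ ∪ K₂) m, D₁ ∪ D₂), (.starcast T m, D ∪ (D₁ ∪ D₂)),
      (.tau, D ∪ (D₁ ∪ D₂))⟩, ⟨h₁, ?_, ?_, .starcast⟩, rfl⟩
    · simp only [e₁, e₂]; exact .arrive
    · simp only [hi]
      exact .castL (Set.union_subset a₁ a₂) (by simp [Set.union_inter_distrib_right, b₁, b₂])
  | relay =>
    obtain ⟨H₁, K₁, D₁, e₁, a₁, b₁⟩ := h₃ .source (by decide)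
    obtain ⟨H₂, K₂, D₂, e₂, a₂, b₂⟩ := h₃ .target (by decide)
    refine ⟨⟨σ, some (.starcast T m, D ∪ D₂), (.starcast T m, D₁ ∪ (D ∪ D₂)),
      (.tau, D₁ ∪ (D ∪ D₂))⟩, ⟨h₁, ?_, ?_, .starcast⟩, rfl⟩
    · simp only [hi, e₂]; exact .castL a₂ b₂
    · simp only [e₁]; exact .castR a₁ b₁
  | target =>
    obtain ⟨H₁, K₁, D₁, e₁, a₁, b₁⟩ := h₃ .source (by decide)
    obtain ⟨H₂, K₂, D₂, e₂, a₂, b₂⟩ := h₃ .relay (by decide)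
    refine ⟨⟨σ, some (.starcast T m, D₂ ∪ D), (.starcast T m, D₁ ∪ (D₂ ∪ D)),
      (.tau, D₁ ∪ (D₂ ∪ D))⟩, ⟨h₁, ?_, ?_, .starcast⟩, rfl⟩
    · simp only [hi, e₂]; exact .castR a₂ b₂
    · simp only [e₁]; exact .castR a₁ b₁

theorem configStep_newpkt {i : Role} {ν' d dip}
    (h : Receives (c i) (.newpkt d dip) ν') :
    ∃ t, ConfigStep addr c t (Function.update c i ν') ∧ t.lab.1 = .newpkt (addr i) d dip := by
  have key : ∀ j, ∃ τ' D, NodeStep (addr j) (c j) τ' (Function.update c i ν' j) ∧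
      τ'.node = some (.arrive (if j = i then {addr j} else ∅) (if j = i then ∅ else {addr j})
        (.newpkt d dip), D) := by
    intro j
    by_cases hj : j = i
    · subst hj
      obtain ⟨ζ, q, hs, rfl⟩ := h
      simp only [Function.update_self, if_true]
      exact ⟨_, _, .ofQueue hs (by simp) .receive, rfl⟩
    · simp only [Function.update_of_ne hj, if_neg hj]
      exact ⟨_, _, .ofNone .notArrive, rfl⟩
  choose σ D h₁ h₂ using key
  -- Encapsulation admits an injection only if the set of receiving nodes is exactly a singleton;
  -- the set of nodes that do not receive may be anything.
  have hH : (if Role.source = i then {addr .source} else ∅) ∪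
      ((if Role.relay = i then {addr .relay} else ∅) ∪
        (if Role.target = i then {addr .target} else ∅)) = ({addr i} : Set IP) := by
    cases i <;> simp
  obtain ⟨w, hw, K, hK⟩ : ∃ w, NetRule (σ .source).node (some (.arrive
      ((if Role.relay = i then {addr .relay} else ∅) ∪
        (if Role.target = i then {addr .target} else ∅))
      ((if Role.relay = i then ∅ else {addr .relay}) ∪
        (if Role.target = i then ∅ else {addr .target})) (.newpkt d dip),
        D .relay ∪ D .target)) w ∧ ∃ K, w = (.arrive {addr i} K (.newpkt d dip), w.2) := by
    rw [h₂]
    exact ⟨_, .arrive, _, by rw [hH]⟩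
  refine ⟨⟨σ, _, w, (.newpkt (addr i) d dip, w.2)⟩, ⟨h₁, ?_, hw, ?_⟩, rfl⟩
  · simp only [h₂]; exact .arrive
  · rw [hK]; exact .newpkt

theorem configStep_connect {x y : IP} (c' : Config IP DATA)
    (hc' : ∀ j, ∃ R, NodeRule (IP := IP) (DATA := DATA) (addr j) (c j).R none (.connect x y, ∅) R ∧
      c' j = { c j with R := R }) :
    ∃ t, ConfigStep addr c t c' ∧ t.lab.1 = .connect x y := by
  have h₁ : ∀ j, NodeStep (addr j) (c j) ⟨none, none, none, some (.connect x y, ∅)⟩ (c' j) := by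
    intro j
    obtain ⟨R, hR, e⟩ := hc' j
    rw [e]
    exact .ofNone hR
  exact ⟨⟨fun _ => ⟨none, none, none, some (.connect x y, ∅)⟩, some (.connect x y, ∅ ∪ ∅),
    (.connect x y, ∅ ∪ (∅ ∪ ∅)), (.connect x y, ∅ ∪ (∅ ∪ ∅))⟩,
    ⟨h₁, .connect, .connect, .connect⟩, rfl⟩

theorem configStep_disconnect {x y : IP} (c' : Config IP DATA)
    (hc' : ∀ j, ∃ R, NodeRule (IP := IP) (DATA := DATA) (addr j) (c j).R none
      (.disconnect x y, ∅) R ∧ c' j = { c j with R := R }) :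
    ∃ t, ConfigStep addr c t c' := by
  have h₁ : ∀ j, NodeStep (addr j) (c j) ⟨none, none, none, some (.disconnect x y, ∅)⟩ (c' j) := by
    intro j
    obtain ⟨R, hR, e⟩ := hc' j
    rw [e]
    exact .ofNone hR
  exact ⟨⟨fun _ => ⟨none, none, none, some (.disconnect x y, ∅)⟩, some (.disconnect x y, ∅ ∪ ∅),
    (.disconnect x y, ∅ ∪ (∅ ∪ ∅)), (.disconnect x y, ∅ ∪ (∅ ∪ ∅))⟩,
    ⟨h₁, .disconnect, .disconnect, .disconnect⟩⟩

end Steps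

/-! ## Internal computations of the processes of a node -/

/-- The valuation that differs from `ξ` only in the value `x` of `v`. -/
abbrev Valuation.set (ξ : Valuation IP DATA) (v : Var) (x : Ty IP DATA v) : Valuation IP DATA :=
  Function.update ξ v (some x)

/-- A state in `Q` can be reached by internal transitions. -/
inductive Reaches (Q : Valuation IP DATA → SP IP DATA → Prop) :
    Valuation IP DATA → SP IP DATA → Prop
  | here {ξ p} (h : Q ξ p) : Reaches Q ξ p
  | step {ξ p ξ' p'} (h : SStep ξ p .tau ξ' p') (h' : Reaches Q ξ' p') : Reaches Q ξ p

/-- A state in `Q` can be reached by a transition labelled `a`. -/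
def Acts (a : SAct IP DATA) (Q : Valuation IP DATA → SP IP DATA → Prop) (ξ : Valuation IP DATA)
    (p : SP IP DATA) : Prop := ∃ ξ' p', SStep ξ p a ξ' p' ∧ Q ξ' p'

/-- The values of the variables that are maintained by the main process. -/
structure Core (ξ : Valuation IP DATA) (ip : IP) (sn : ℕ) (rt : RT IP) (rreqs : Set (IP × ℕ))
    (store : Store IP DATA) : Prop where
  ip : ξ .ip = some ip
  sn : ξ .sn = some sn
  rt : ξ .rt = some rt
  rreqs : ξ .rreqs = some rreqs
  store : ξ .store = some store

/-- The valuation of exactly the variables maintained by the main process. -/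
def coreVal (ip : IP) (sn : ℕ) (rt : RT IP) (rreqs : Set (IP × ℕ)) (store : Store IP DATA) :
    Valuation IP DATA
  | .ip => some ip
  | .sn => some sn
  | .rt => some rt
  | .rreqs => some rreqs
  | .store => some store
  | _ => none

/-- The main process is about to execute the basic routine. -/
def Idle (ip : IP) (sn : ℕ) (rt : RT IP) (rreqs : Set (IP × ℕ)) (store : Store IP DATA)
    (ξ : Valuation IP DATA) (p : SP IP DATA) : Prop :=
  p = callSame .AODV ∧ Core ξ ip sn rt rreqs store

/-- A guard without unbound variables is a mere test and leaves the valuation as it is. -/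
theorem Formula.Sat.self {φ : Formula IP DATA} {ξ : Valuation IP DATA}
    (hfree : ∀ v ∈ φ.free, (ξ v).isSome) (h : φ.holds ξ) : φ.Sat ξ ξ :=
  ⟨fun _ _ => rfl, fun v => ⟨.inl, fun hv => hv.elim id (hfree v)⟩, h⟩

/-- Binding of the variables in `vs`. -/
theorem Formula.Sat.bind {φ : Formula IP DATA} {ξ ζ : Valuation IP DATA} (vs : List Var)
    (hvs : ∀ v ∈ vs, ξ v = none) (hζ : ∀ v, v ∈ vs ∨ ζ v = ξ v)
    (hfree : ∀ v ∈ φ.free, (ζ v).isSome) (hsub : ∀ v ∈ vs, v ∈ φ.free) (h : φ.holds ζ) :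
    φ.Sat ξ ζ := by
  refine ⟨fun v hv => (hζ v).resolve_left fun hm => by simp [hvs v hm] at hv,
    fun v => ⟨fun hv => ?_, fun hv => hv.elim (fun hv => ?_) (hfree v)⟩, h⟩
  · rcases hζ v with hm | he
    · exact .inr (hsub v hm)
    · exact .inl (he ▸ hv)
  · rcases hζ v with hm | he
    · simp [hvs v hm] at hv
    · rwa [he]

/-! ### Runs of the main process. -/

section Main

variable {ξ : Valuation IP DATA} {ip : IP} {sn : ℕ} {rt : RT IP} {rreqs : Set (IP × ℕ)}
  {store : Store IP DATA}

/-- A call keeps the formal parameters only. All local variables left over from earlier rounds are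
forgotten, which is why the guards of the basic routine can bind them afresh. -/
theorem Core.callVal (h : Core ξ ip sn rt rreqs store) :
    callVal .AODV (fun v ξ => ξ v) ξ = coreVal ip sn rt rreqs store := by
  funext v
  cases v <;> simp [AODV.callVal, params, coreVal, h.ip, h.sn, h.rt, h.rreqs, h.store]

theorem Core.step (h : Core ξ ip sn rt rreqs store) {a ζ p'}
    (hs : SStep (coreVal ip sn rt rreqs store) bodyAODV a ζ p') :
    SStep ξ (callSame .AODV) a ζ p' := by
  refine .call ?_ (h.callVal ▸ hs)
  simp [params, h.ip, h.sn, h.rt, h.rreqs, h.store]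

theorem handles_newpkt (h : Core ξ ip sn rt rreqs store) {x : DATA} {dip : IP} (hd : dip ≠ ip) :
    Acts (.receive (.newpkt x dip)) (Reaches (Idle ip sn rt rreqs (add x dip store)))
      ξ (callSame .AODV) := by
  refine ⟨_, _, h.step (.choiceL (.receive _)),
    -- The guard matches the received message against a pattern: the only extension that satisfies
    -- it assigns the fields of the message to the unbound variables. The other message handlers
    -- proceed in the same way.
    .step (.choiceL (.guard (.bind (ζ :=
      coreVal ip sn rt rreqs store
        |>.set .msg (.newpkt x dip) |>.set .data x |>.set .dip dip) [.data, .dip] ?_ ?_ ?_ ?_ ?_))) <|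
    .step (.call ?_ (.choiceR (.guard (.self ?_ hd)))) <|
    .step (.assign rfl) <|
    .here ⟨rfl, rfl, rfl, rfl, rfl, rfl⟩⟩
  · intro v hv; cases v <;> first | rfl | simp at hv
  · intro v; cases v <;> first | exact .inr rfl | exact .inl (by simp)
  · intro v hv; cases v <;> first | rfl | simp at hv
  · simp
  · exact (rfl : Msg.newpkt x dip = _)
  · intro v hv; cases v <;> first | rfl | simp [params] at hv
  · intro v hv; cases v <;> first | rfl | simp at hv

/-- The basic routine initiates a route discovery. -/
theorem reaches_broadcast_rreq (h : Core ξ ip sn rt rreqs store) {dip : IP}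
    (hd : dip ∈ qD store \ vD rt) (hq : qflag store dip = some .req) :
    Reaches (Acts (.broadcast (.rreq 0 (nrreqid rreqs ip) dip (sqn rt dip) (sqnf rt dip) ip
        (inc sn) ip))
      (Idle ip (inc sn) rt (rreqs ∪ {(ip, nrreqid rreqs ip)}) (unsetRRF store dip)))
      ξ (callSame .AODV) := by
  refine .step (h.step (.choiceR (.choiceR (.guard (.bind
      (ζ := Function.update (coreVal ip sn rt rreqs store) .dip (some dip)) [.dip]
      ?_ ?_ ?_ ?_ ⟨hd, ?_⟩))))) <|
    .step (.assign rfl) <| .step (.assign rfl) <| .step (.assign rfl) <| .step (.assign rfl) <|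
    .here ⟨_, _, .broadcast rfl, rfl, rfl, rfl, rfl, rfl, rfl⟩
  · intro v hv; cases v <;> first | rfl | simp at hv
  · intro v; cases v <;> first | exact .inr rfl | exact .inl (by simp)
  · intro v hv; cases v <;> first | rfl | simp at hv
  · simp
  · change truth (do return (← qflag store dip) = .req)
    simp [hq, truth]

/-- The basic routine sends a queued data packet. -/
theorem reaches_unicast_pkt (h : Core ξ ip sn rt rreqs store) {dip nh : IP} {data : DATA}
    {store' : Store IP DATA} (hd : dip ∈ qD store ∩ vD rt)
    (hx : (selqueue store dip).head? = some data) (hn : nhop rt dip = some nh)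
    (hs : drop dip store = some store') :
    Reaches (Acts (.unicast nh (.pkt data dip ip)) (Reaches (Idle ip sn rt rreqs store')))
      ξ (callSame .AODV) := by
  refine .step (h.step (.choiceR (.choiceL (.guard (.bind
      (ζ := Function.update (coreVal ip sn rt rreqs store) .dip (some dip)) [.dip]
      ?_ ?_ ?_ ?_ hd))))) <|
    .step (.assign hx) <|
    .here ⟨_, _, .unicast hn rfl, .step (.assign hs) <| .here ⟨rfl, rfl, rfl, rfl, rfl, rfl⟩⟩
  · intro v hv; cases v <;> first | rfl | simp at hv
  · intro v; cases v <;> first | exact .inr rfl | exact .inl (by simp)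
  · intro v hv; cases v <;> first | rfl | simp at hv
  · simp

/-- A data packet without a valid route is dropped. -/
theorem handles_pkt_noRoute (h : Core ξ ip sn rt rreqs store) {data : DATA} {dip oip : IP}
    {P : Set IP} (hd : dip ≠ ip) (hv : dip ∉ vD rt) (hi : dip ∈ iD rt)
    (hP : precs rt dip = some P) :
    Acts (.receive (.pkt data dip oip)) (Reaches
      (Acts (.groupcast P (.rerr (singleDest dip (sqn rt dip)) ip))
        (Idle ip sn rt rreqs store))) ξ (callSame .AODV) := by
  refine ⟨_, _, h.step (.choiceL (.receive _)),
    .step (.choiceR (.choiceL (.guard (.bind (ζ :=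
      coreVal ip sn rt rreqs store
        |>.set .msg (.pkt data dip oip) |>.set .data data |>.set .dip dip |>.set .oip oip)
      [.data, .dip, .oip] ?_ ?_ ?_ ?_ ?_)))) <|
    .step (.call ?_ (.choiceR (.guard (.self ?_ hd)))) <|
    .step (.choiceR (.guard (.self ?_ hv))) <|
    .step (.choiceL (.guard (.self ?_ hi))) <|
    .here ⟨_, _, .groupcast hP rfl, rfl, rfl, rfl, rfl, rfl, rfl⟩⟩
  · intro v hv; cases v <;> first | rfl | simp at hv
  · intro v; cases v <;> first | exact .inr rfl | exact .inl (by simp)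
  · intro v hv; cases v <;> first | rfl | simp at hv
  · simp
  · exact (rfl : Msg.pkt data dip oip = _)
  · intro v hv; cases v <;> first | rfl | simp [params] at hv
  · intro v hv; cases v <;> first | rfl | simp at hv
  · intro v hv; cases v <;> first | rfl | simp at hv
  · intro v hv; cases v <;> first | rfl | simp at hv

/-- A route request is forwarded. -/
theorem handles_rreq_forward (h : Core ξ ip sn rt rreqs store) {hops rreqid dsn osn : ℕ}
    {dsk : SQNK} {dip oip sip : IP} {rt₁ rt₂ : RT IP}
    (h₁ : update rt sip ⟨0, .unk, .val, 1, sip, ∅⟩ = some rt₁) (hr : (oip, rreqid) ∉ rreqs)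
    (h₂ : update rt₁ oip ⟨osn, .kno, .val, hops + 1, sip, ∅⟩ = some rt₂)
    (hd : dip ≠ ip) (hv : dip ∉ vD rt₂) :
    Acts (.receive (.rreq hops rreqid dip dsn dsk oip osn sip)) (Reaches
      (Acts (.broadcast (.rreq (hops + 1) rreqid dip (max (sqn rt₂ dip) dsn) dsk oip osn ip))
        (Idle ip sn rt₂ (rreqs ∪ {(oip, rreqid)}) store))) ξ (callSame .AODV) := by
  refine ⟨_, _, h.step (.choiceL (.receive _)),
    .step (.choiceR (.choiceR (.choiceL (.guard (.bind (ζ :=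
      coreVal ip sn rt rreqs store
        |>.set .msg (.rreq hops rreqid dip dsn dsk oip osn sip) |>.set .hops hops
        |>.set .rreqid rreqid |>.set .dip dip |>.set .dsn dsn |>.set .dsk dsk |>.set .oip oip
        |>.set .osn osn |>.set .sip sip) [.hops, .rreqid, .dip, .dsn, .dsk, .oip, .osn, .sip]
      ?_ ?_ ?_ ?_ ?_))))) <|
    .step (.assign h₁) <|
    .step (.call ?_ (.choiceR (.guard (.self ?_ hr)))) <|
    .step (.assign h₂) <| .step (.assign rfl) <|
    .step (.choiceR (.guard (.self ?_ hd))) <|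
    .step (.choiceR (.guard (.self ?_ (.inl hv)))) <|
    .here ⟨_, _, .broadcast rfl, rfl, rfl, rfl, rfl, rfl, rfl⟩⟩
  · intro v hv; cases v <;> first | rfl | simp at hv
  · intro v; cases v <;> first | exact .inr rfl | exact .inl (by simp)
  · intro v hv; cases v <;> first | rfl | simp at hv
  · simp
  · exact (rfl : Msg.rreq hops rreqid dip dsn dsk oip osn sip = _)
  · intro v hv; cases v <;> first | rfl | simp [params] at hv
  · intro v hv; cases v <;> first | rfl | simp at hv
  · intro v hv; cases v <;> first | rfl | simp at hv
  · intro v hv; cases v <;> first | rfl | simp at hv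

/-- A route request is answered by its destination. -/
theorem handles_rreq_reply (h : Core ξ ip sn rt rreqs store) {hops rreqid dsn osn : ℕ}
    {dsk : SQNK} {oip sip nh : IP} {rt₁ rt₂ : RT IP}
    (h₁ : update rt sip ⟨0, .unk, .val, 1, sip, ∅⟩ = some rt₁) (hr : (oip, rreqid) ∉ rreqs)
    (h₂ : update rt₁ oip ⟨osn, .kno, .val, hops + 1, sip, ∅⟩ = some rt₂)
    (hn : nhop rt₂ oip = some nh) :
    Acts (.receive (.rreq hops rreqid ip dsn dsk oip osn sip)) (Reaches
      (Acts (.unicast nh (.rrep 0 ip (max sn dsn) oip ip))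
        (Idle ip (max sn dsn) rt₂ (rreqs ∪ {(oip, rreqid)}) store))) ξ (callSame .AODV) := by
  refine ⟨_, _, h.step (.choiceL (.receive _)),
    .step (.choiceR (.choiceR (.choiceL (.guard (.bind (ζ :=
      coreVal ip sn rt rreqs store
        |>.set .msg (.rreq hops rreqid ip dsn dsk oip osn sip) |>.set .hops hops
        |>.set .rreqid rreqid |>.set .dip ip |>.set .dsn dsn |>.set .dsk dsk |>.set .oip oip
        |>.set .osn osn |>.set .sip sip) [.hops, .rreqid, .dip, .dsn, .dsk, .oip, .osn, .sip]
      ?_ ?_ ?_ ?_ ?_))))) <|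
    .step (.assign h₁) <|
    .step (.call ?_ (.choiceR (.guard (.self ?_ hr)))) <|
    .step (.assign h₂) <| .step (.assign rfl) <|
    .step (.choiceL (.guard (.self ?_ (rfl : ip = ip)))) <|
    .step (.assign rfl) <|
    .here ⟨_, _, .unicast hn rfl, rfl, rfl, rfl, rfl, rfl, rfl⟩⟩
  · intro v hv; cases v <;> first | rfl | simp at hv
  · intro v; cases v <;> first | exact .inr rfl | exact .inl (by simp)
  · intro v hv; cases v <;> first | rfl | simp at hv
  · simp
  · exact (rfl : Msg.rreq hops rreqid ip dsn dsk oip osn sip = _)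
  · intro v hv; cases v <;> first | rfl | simp [params] at hv
  · intro v hv; cases v <;> first | rfl | simp at hv
  · intro v hv; cases v <;> first | rfl | simp at hv

/-- The set of broken destinations and the invalidated table enter through equations, so that a
caller can supply them in simplified form. -/
theorem reaches_linkBreak (h : Core ξ ip sn rt rreqs store) {dst : Exp IP DATA IP} {x : IP}
    (hx : dst ξ = some x) {dests : Dests IP} {rt' : RT IP}
    (hdests : brokenDests rt x = dests) (hrt' : invalidate rt dests = rt') :
    Reaches (Acts (.groupcast (allPrecs rt' dests) (.rerr (destsWithPrecs rt' dests) ip))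
      (Idle ip sn rt' rreqs (setRRF store dests))) ξ (linkBreak dst) := by
  refine .step (.assign (x := dests) ?_) <| .step (.assign (x := rt') ?_) <|
    .step (.assign (x := setRRF store dests) ?_) <|
    .step (.assign (x := allPrecs rt' dests) ?_) <|
    .step (.assign (x := destsWithPrecs rt' dests) ?_) <|
    .here ⟨_, _, .groupcast (D := allPrecs rt' dests) ?_ ?_, rfl, ?_⟩
  rotate_right
  · constructor <;> simp [h.ip, h.sn, h.rreqs]
  all_goals simp [h.rt, h.store, h.ip, hx, hdests, hrt']

/-- A route reply cannot be forwarded, because the link to the next hop is broken. -/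
theorem handles_rrep_linkBreak (h : Core ξ ip sn rt rreqs store) {hops dsn : ℕ}
    {dip oip sip nhd nho : IP} {rt₁ rt₂ rt₃ rt₄ rt₅ : RT IP} {dests : Dests IP}
    (h₁ : update rt sip ⟨0, .unk, .val, 1, sip, ∅⟩ = some rt₁)
    (h₂ : update rt₁ dip ⟨dsn, .kno, .val, hops + 1, sip, ∅⟩ = some rt₂) (hne : rt₁ ≠ rt₂)
    (ho : oip ≠ ip) (hv : oip ∈ vD rt₂) (hno : nhop rt₂ oip = some nho)
    (h₃ : addpreRT rt₂ dip {nho} = some rt₃) (hnd : nhop rt₃ dip = some nhd)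
    (hno' : nhop rt₃ oip = some nho) (h₄ : addpreRT rt₃ nhd {nho} = some rt₄)
    (hno'' : nhop rt₄ oip = some nho) (hdests : brokenDests rt₄ oip = dests)
    (h₅ : invalidate rt₄ dests = rt₅) :
    Acts (.receive (.rrep hops dip dsn oip sip)) (Reaches
      (Acts (.notUnicast nho (.rrep (hops + 1) dip dsn oip ip)) (Reaches
        (Acts (.groupcast (allPrecs rt₅ dests) (.rerr (destsWithPrecs rt₅ dests) ip))
          (Idle ip sn rt₅ rreqs (setRRF store dests)))))) ξ (callSame .AODV) := by
  refine ⟨_, _, h.step (.choiceL (.receive _)),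
    .step (.choiceR (.choiceR (.choiceR (.choiceL (.guard (.bind (ζ :=
      coreVal ip sn rt rreqs store
        |>.set .msg (.rrep hops dip dsn oip sip) |>.set .hops hops |>.set .dip dip
        |>.set .dsn dsn |>.set .oip oip |>.set .sip sip) [.hops, .dip, .dsn, .oip, .sip]
      ?_ ?_ ?_ ?_ ?_)))))) <|
    .step (.assign h₁) <|
    .step (.call ?_ (.choiceL (.guard (.self ?_ ?_)))) <|
    .step (.assign h₂) <|
    .step (.choiceR (.guard (.self ?_ ho))) <|
    .step (.choiceL (.guard (.self ?_ hv))) <|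
    .step (.assign (x := rt₃) ?_) <|
    .step (.assign (x := rt₄) ?_) <|
    .here ⟨_, _, .notUnicast ?_ ?_,
      reaches_linkBreak ?_ ?_ hdests h₅⟩⟩
  · intro v hv; cases v <;> first | rfl | simp at hv
  · intro v; cases v <;> first | exact .inr rfl | exact .inl (by simp)
  · intro v hv; cases v <;> first | rfl | simp at hv
  · simp
  · exact (rfl : Msg.rrep hops dip dsn oip sip = _)
  · intro v hv; cases v <;> first | rfl | simp [params] at hv
  · intro v hv; cases v <;> first | rfl | simp at hv
  · change truth (do return rt₁ ≠ (← update rt₁ dip ⟨dsn, .kno, .val, hops + 1, sip, ∅⟩))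
    simpa [h₂, truth] using hne
  · intro v hv; cases v <;> first | rfl | simp at hv
  · intro v hv; cases v <;> first | rfl | simp at hv
  · change (do addpreRT rt₂ dip {← nhop rt₂ oip}) = some rt₃
    simpa [hno] using h₃
  · change (do addpreRT rt₃ (← nhop rt₃ dip) {← nhop rt₃ oip}) = some rt₄
    simpa [hno', hnd] using h₄
  · exact hno''
  · rfl
  · exact ⟨rfl, rfl, rfl, rfl, rfl⟩
  · rfl

end Main

/-! ## Message queues -/

/-- The message queue contains the messages `ms`. -/
def IsQueue (ms : List (Msg IP DATA)) (ζ : Valuation IP DATA) (q : SP IP DATA) : Prop :=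
  ∃ args, q = .call .QMSG args ∧ args .msgs ζ = some ms

section Queue

variable {ms : List (Msg IP DATA)} {ζ : Valuation IP DATA} {q : SP IP DATA}

/-- After a receipt the new content is not yet stored in the valuation: it is the value of the
argument of the pending call, and is computed when that call is unfolded. -/
theorem IsQueue.receive (h : IsQueue ms ζ q) (m : Msg IP DATA) :
    Acts (.receive m) (IsQueue (ms ++ [m])) ζ q := by
  obtain ⟨args, rfl, h⟩ := h
  refine ⟨_, _, .call (by simp [params, h]) (.choiceL (.receive m)), _, rfl, ?_⟩
  change (do return (← callVal .QMSG args ζ .msgs) ++ [m]) = _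
  simp [callVal, params, h]

/-- Sending takes two transitions, since the test for nonemptiness is an internal step of its own.
-/
theorem IsQueue.send {m : Msg IP DATA} (h : IsQueue (m :: ms) ζ q) :
    Acts .tau (Acts (.send m) (IsQueue ms)) ζ q := by
  obtain ⟨args, rfl, h⟩ := h
  have hv : callVal .QMSG args ζ .msgs = some (m :: ms) := by simp [callVal, params, h]
  refine ⟨_, _, .call (by simp [params, h]) (.choiceR (.guard (.self ?_ ?_))),
    ⟨_, _, .choiceL (.send ?_), _, rfl, ?_⟩⟩
  · simp [hv]
  · simp [hv, truth]
  · simp [hv]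
  · simp [hv]

end Queue

/-! ## Paths -/

/-- `l` lists the labels of a path from `c` to `c'`. -/
inductive Path (addr : Role → IP) :
    Config IP DATA → List (Tick IP DATA) → Config IP DATA → Prop
  | nil (c) : Path addr c [] c
  | cons {c t c' l c''} (h : ConfigStep addr c t c') (h' : Path addr c' l c'') :
      Path addr c (t :: l) c''

variable (IP DATA) in
inductive Event
  | sync (i : Role)
  | newpkt (ip : IP) (d : DATA) (dip : IP)

def Tick.Has (addr : Role → IP) (t : Tick IP DATA) : Event IP DATA → Prop
  | .sync i => t.IsSync addr i
  | .newpkt ip d dip => t.lab.1 = .newpkt ip d dip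

/-- There is a path from `c` to `c'` without deliveries and disconnections, on which all events in
`es` occur. -/
def Reach (addr : Role → IP) (c : Config IP DATA) (es : List (Event IP DATA))
    (c' : Config IP DATA) : Prop :=
  ∃ l, Path addr c l c' ∧ (∀ t ∈ l, t.Safe) ∧ ∀ e ∈ es, ∃ t ∈ l, t.Has addr e

/-! ### Composite moves of one node, lifted to paths of the network. -/

section Reach

variable {addr : Role → IP} {c c' c'' : Config IP DATA} {es es' : List (Event IP DATA)}

theorem Path.trans {l l'} (h : Path addr c l c') (h' : Path addr c' l' c'') :
    Path addr c (l ++ l') c'' := by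
  induction h with
  | nil => exact h'
  | cons hs _ ih => exact .cons hs (ih h')

theorem Reach.refl (c : Config IP DATA) : Reach addr c [] c := ⟨[], .nil c, by simp, by simp⟩

theorem Reach.single {t} (h : ConfigStep addr c t c') (hs : t.Safe)
    (he : ∀ e ∈ es, t.Has addr e) : Reach addr c es c' :=
  ⟨[t], .cons h (.nil _), by simpa using hs, by simpa using he⟩

theorem Reach.trans (h : Reach addr c es c') (h' : Reach addr c' es' c'') :
    Reach addr c (es ++ es') c'' := by
  obtain ⟨l, h₁, h₂, h₃⟩ := h
  obtain ⟨l', h₁', h₂', h₃'⟩ := h'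
  refine ⟨l ++ l', h₁.trans h₁', fun t ht => ?_, fun e he => ?_⟩
  · exact (List.mem_append.1 ht).elim (h₂ t) (h₂' t)
  · rcases List.mem_append.1 he with he | he
    · exact (h₃ e he).imp fun t ht => ⟨List.mem_append_left _ ht.1, ht.2⟩
    · exact (h₃' e he).imp fun t ht => ⟨List.mem_append_right _ ht.1, ht.2⟩

theorem Tick.safe_of_tau {t : Tick IP DATA} (h : t.lab.1 = .tau) : t.Safe := by
  constructor <;> simp [h]

variable {i : Role}

/-- The main process of the node satisfies `Q`, the message queue
contains `ms` and the transmission range is `R`. -/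
structure IsNode (Q : Valuation IP DATA → SP IP DATA → Prop) (ms : List (Msg IP DATA)) (R : Set IP)
    (ν : NodeState IP DATA) : Prop where
  main : Q ν.ξ ν.p
  queue : IsQueue ms ν.ζ ν.q
  range : ν.R = R

variable {Q Q' : Valuation IP DATA → SP IP DATA → Prop} {ms ms' : List (Msg IP DATA)}
  {R R' : Set IP}

/-- The queue is always ready to receive, whatever the main process is doing, so no transmission is
ever blocked by its addressees. -/
theorem IsNode.receives {ν : NodeState IP DATA} (h : IsNode Q ms R ν) (m : Msg IP DATA) :
    ∃ ν', Receives ν m ν' ∧ IsNode Q (ms ++ [m]) R ν' := by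
  obtain ⟨ζ, q, hs, hq⟩ := h.queue.receive m
  exact ⟨_, ⟨ζ, q, hs, rfl⟩, h.main, hq, h.range⟩

theorem reach_newpkt (h : IsNode Q ms R (c i)) (d : DATA) (dip : IP) :
    ∃ c', Reach addr c [.newpkt (addr i) d dip] c' ∧
      IsNode Q (ms ++ [.newpkt d dip]) R (c' i) ∧ ∀ j ≠ i, c' j = c j := by
  obtain ⟨ν', hr, hν'⟩ := IsNode.receives h (.newpkt d dip)
  obtain ⟨t, ht, hl⟩ := configStep_newpkt (addr := addr) hr
  refine ⟨_, .single ht (by constructor <;> simp [hl]) (by simpa [Tick.Has] using hl), ?_, ?_⟩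
  · simpa using hν'
  · intro j hj; simp [hj]

theorem reach_tau {τ : NodeTick IP DATA} {ν' D} (h : NodeStep (addr i) (c i) τ ν')
    (hτ : τ.node = some (.tau, D)) : Reach addr c [] (Function.update c i ν') := by
  obtain ⟨t, ht, hl, -⟩ := configStep_tau h hτ
  exact .single ht (Tick.safe_of_tau (by simp [hl])) (by simp)

theorem reach_reaches (h : IsNode (Reaches Q) ms R (c i)) :
    ∃ c', Reach addr c [] c' ∧ IsNode Q ms R (c' i) ∧ ∀ j ≠ i, c' j = c j := by
  obtain ⟨h₁, h₂, h₃⟩ := h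
  generalize hξ : (c i).ξ = ξ at h₁
  generalize hp : (c i).p = p at h₁
  induction h₁ generalizing c with
  | here h => exact ⟨c, .refl c, ⟨hξ ▸ hp ▸ h, h₂, h₃⟩, fun _ _ => rfl⟩
  | @step _ _ ξ' p' hs _ ih =>
    subst hξ hp
    have hr := reach_tau (addr := addr) (.ofMain (ip := addr i) hs (by simp) .tau) rfl
    obtain ⟨c', hc', hi, ho⟩ := ih (c := Function.update c i { c i with ξ := ξ', p := p' })
      (by simpa using h₂)
      (by simpa using h₃) (by simp) (by simp)
    exact ⟨c', hr.trans hc', hi, fun j hj => by simp [ho j hj, hj]⟩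

/-- Three phases: the queue passes its nonemptiness test, queue and main process synchronise on the
head message, and the main process runs its internal computation. The middle step is the event that
is recorded. -/
theorem reach_handle {m : Msg IP DATA}
    (h : IsNode (Acts (.receive m) (Reaches Q)) (m :: ms) R (c i)) :
    ∃ c', Reach addr c [.sync i] c' ∧ IsNode Q ms R (c' i) ∧ ∀ j ≠ i, c' j = c j := by
  obtain ⟨⟨ξ, p, hs, hQ⟩, hq, hR⟩ := h
  obtain ⟨ζ₁, q₁, hq₁, ζ₂, q₂, hq₂, hq⟩ := hq.send
  have hr₁ := reach_tau (addr := addr) (.ofQueue (ip := addr i) hq₁ (by simp) .tau) rfl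
  have hn := NodeStep.sync (ip := addr i)
    (ν := Function.update c i { c i with ζ := ζ₁, q := q₁ } i)
    (by simpa using hs) (by simpa using hq₂)
  obtain ⟨t, ht, hl, hti, hp⟩ := configStep_tau hn rfl
  have hr₂ : Reach addr _ [.sync i] _ := .single ht (Tick.safe_of_tau (by simp [hl])) (by
    simp only [List.mem_singleton, forall_eq]
    constructor
    iterate 4 simp [hti]
    · exact hp
    · exact ⟨m, by simp [hl, tag]⟩)
  obtain ⟨c', hr₃, hi, ho⟩ := reach_reaches (addr := addr) (i := i) (Q := Q) (ms := ms) (R := R)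
    (c := Function.update (Function.update c i { c i with ζ := ζ₁, q := q₁ }) i
      ⟨ξ, p, ζ₂, q₂, (Function.update c i { c i with ζ := ζ₁, q := q₁ } i).R⟩)
    ⟨by simpa using hQ, by simpa using hq, by simpa using hR⟩
  exact ⟨c', (hr₁.trans hr₂).trans hr₃, hi, fun j hj => by simp [ho j hj, hj]⟩

theorem reach_notUnicast {dip : IP} {m : Msg IP DATA}
    (h : IsNode (Acts (.notUnicast dip m) Q) ms R (c i)) (hd : dip ∉ R) :
    ∃ c', Reach addr c [] c' ∧ IsNode Q ms R (c' i) ∧ ∀ j ≠ i, c' j = c j := by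
  obtain ⟨⟨ξ, p, hs, hQ⟩, hq, rfl⟩ := h
  exact ⟨_, reach_tau (.ofMain (ip := addr i) hs (by simp) (.notUnicast hd)) rfl,
    ⟨by simpa using hQ, by simpa using hq, by simp⟩, fun j hj => by simp [hj]⟩

/-- A message is transmitted to exactly one node. -/
theorem reach_cast {j : Role} {a : SAct IP DATA} {T : Set IP} {m : Msg IP DATA} {D}
    (h : IsNode (Acts a Q) ms R (c i)) (ha : ∀ m, a ≠ .receive m)
    (hT : NodeRule (addr i) R (some (a, {a})) (.starcast T m, D) R) (hij : j ≠ i)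
    (h' : IsNode Q' ms' R' (c j)) (hj : addr j ∈ T) (hk : ∀ k ≠ i, k ≠ j → addr k ∉ T) :
    ∃ c', Reach addr c [] c' ∧ IsNode Q ms R (c' i) ∧ IsNode Q' (ms' ++ [m]) R' (c' j) ∧
      ∀ k ≠ i, k ≠ j → c' k = c k := by
  obtain ⟨⟨ξ, p, hs, hQ⟩, hq, rfl⟩ := h
  obtain ⟨ν', hr, hν'⟩ := IsNode.receives h' m
  have hn := NodeStep.ofMain (ip := addr i) hs ha hT
  obtain ⟨t, ht, hl⟩ := configStep_starcast (addr := addr) (c := c) (i := i) (T := T) (m := m)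
    (D := D)
    (c' := Function.update (Function.update c j ν') i { c i with ξ := ξ, p := p })
    (by simpa using hn) rfl (by
      intro k hki
      by_cases hkj : k = j
      · subst hkj
        simpa [hki, hj] using hr
      · simp [hki, hkj, hk k hki hkj])
  exact ⟨_, .single ht (Tick.safe_of_tau hl) (by simp), ⟨by simpa using hQ, by simpa using hq,
    by simp⟩, by simpa [hij] using hν', fun k h₁ h₂ => by simp [h₁, h₂]⟩

theorem reach_groupcast_empty {m : Msg IP DATA} (h : IsNode (Acts (.groupcast ∅ m) Q) ms R (c i)) :
    ∃ c', Reach addr c [] c' ∧ IsNode Q ms R (c' i) ∧ ∀ j ≠ i, c' j = c j := by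
  obtain ⟨⟨ξ, p, hs, hQ⟩, hq, hR⟩ := h
  have hn := NodeStep.ofMain (ip := addr i) hs (by simp) .groupcast
  obtain ⟨t, ht, hl⟩ := configStep_starcast (addr := addr) (c := c) (i := i) (m := m)
    (T := (c i).R ∩ ∅) (c' := Function.update c i { c i with ξ := ξ, p := p })
    (by rwa [Function.update_self]) rfl (by simp +contextual)
  exact ⟨_, .single ht (Tick.safe_of_tau hl) (by simp), ⟨by simpa using hQ, by simpa using hq,
    by simpa using hR⟩, fun k h₁ => by simp [h₁]⟩

end Reach

/-! ## Infinite paths -/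

section Infinite

variable {addr : Role → IP} {es : List (Event IP DATA)} {P : Config IP DATA → Prop}

/-- If each state in `P` leads back to `P` by a path with the events `es`, then each path to `P`
can be continued to an infinite path on which these events occur infinitely often. -/
theorem exists_infinite_path {c₀ c₁ : Config IP DATA} {l₀} (hes : es ≠ [])
    (h₀ : Path addr c₀ l₀ c₁) (h₁ : P c₁) (hP : ∀ c, P c → ∃ c', Reach addr c es c' ∧ P c') :
    ∃ (c : ℕ → Config IP DATA) (t : ℕ → Tick IP DATA), c 0 = c₀ ∧
      (∀ n, ConfigStep addr (c n) (t n) (c (n + 1))) ∧ (∀ N, ∃ n ≥ N, P (c n)) ∧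
      (∀ e ∈ es, ∀ N, ∃ n ≥ N, (t n).Has addr e) ∧ ∃ N, ∀ n ≥ N, (t n).Safe := by
  -- The state of the iteration is a configuration with the nonempty list of steps still to be
  -- performed, leading to `P`. When the list runs out, a new segment is fetched; such a state is
  -- `Fresh`.
  let Pending := {x : Config IP DATA × List (Tick IP DATA) //
    x.2 ≠ [] ∧ ∃ c', Path addr x.1 x.2 c' ∧ P c'}
  let Fresh : Pending → Prop := fun x =>
    P x.1.1 ∧ (∀ t ∈ x.1.2, t.Safe) ∧ ∀ e ∈ es, ∃ t ∈ x.1.2, t.Has addr e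
  have fresh : ∀ c, P c → ∃ x : Pending, x.1.1 = c ∧ Fresh x := by
    intro c hc
    obtain ⟨c', ⟨l, hl, hs, he⟩, hc'⟩ := hP c hc
    refine ⟨⟨(c, l), ?_, c', hl, hc'⟩, rfl, hc, hs, he⟩
    rintro rfl
    obtain ⟨e, he'⟩ := List.exists_mem_of_ne_nil es hes
    simpa using he e he'
  have next : ∀ x : Pending, ∃ (y : Pending) (t : Tick IP DATA) (l : List (Tick IP DATA)),
      x.1.2 = t :: l ∧ ConfigStep addr x.1.1 t y.1.1 ∧
        (l ≠ [] → y.1.2 = l) ∧ (l = [] → Fresh y) := by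
    rintro ⟨⟨c, l⟩, hl, c', hp, hc'⟩
    cases hp with
    | nil => exact absurd rfl hl
    | @cons _ t c₂ l _ hs hp =>
      by_cases hl' : l = []
      · subst hl'
        cases hp
        obtain ⟨y, rfl, hy⟩ := fresh _ hc'
        exact ⟨y, t, [], rfl, hs, fun h => absurd rfl h, fun _ => hy⟩
      · exact ⟨⟨(c₂, l), hl', c', hp, hc'⟩, t, l, rfl, hs, fun _ => rfl, fun h => absurd h hl'⟩
  choose nxt tick rest hrest hstep hcont hfresh using next
  obtain ⟨x₀, hx₀⟩ : ∃ x : Pending, x.1.1 = c₀ := by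
    obtain ⟨x, hx, -⟩ := fresh c₁ h₁
    obtain ⟨c', hp, hc'⟩ := x.2.2
    -- The initial path may be empty, so a first segment of the loop is appended to it.
    exact ⟨⟨(c₀, l₀ ++ x.1.2), by simp [x.2.1], c', h₀.trans (hx ▸ hp), hc'⟩, rfl⟩
  let x : ℕ → Pending := fun n => nxt^[n] x₀
  have hx : ∀ n, x (n + 1) = nxt (x n) := fun n => Function.iterate_succ_apply' nxt n x₀
  -- A pending list of `k + 1` steps is executed completely in the next `k + 1` steps, after which a
  -- fresh segment begins.
  have key : ∀ k n, (x n).1.2.length = k + 1 → Fresh (x (n + k + 1)) ∧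
      ∀ t ∈ (x n).1.2, ∃ i ≤ k, tick (x (n + i)) = t := by
    intro k
    induction k with
    | zero =>
      intro n hn
      rw [hrest] at hn ⊢
      have hnil : rest (x n) = [] := by simpa using hn
      refine ⟨?_, ?_⟩
      · rw [add_zero, hx]; exact hfresh _ hnil
      · simp [hnil]
    | succ k ih =>
      intro n hn
      rw [hrest] at hn ⊢
      have hlen : (rest (x n)).length = k + 1 := by simpa using hn
      have he : (x (n + 1)).1.2 = rest (x n) := by
        rw [hx]; exact hcont _ fun h => by simp [h] at hlen
      obtain ⟨h₁, h₂⟩ := ih (n + 1) (by rw [he, hlen])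
      refine ⟨by convert h₁ using 2; omega, fun t ht => ?_⟩
      rcases List.mem_cons.1 ht with rfl | ht
      · exact ⟨0, by omega, rfl⟩
      · obtain ⟨i, hi, rfl⟩ := h₂ t (he ▸ ht)
        exact ⟨i + 1, by omega, by congr 2; omega⟩
  have hF : ∀ N, ∃ n ≥ N, Fresh (x n) := fun N => by
    obtain ⟨k, hk⟩ := Nat.exists_eq_succ_of_ne_zero
      (mt List.length_eq_zero_iff.1 (x N).2.1)
    exact ⟨N + k + 1, by omega, (key k N hk).1⟩
  refine ⟨fun n => (x n).1.1, fun n => tick (x n), hx₀, fun n => ?_, fun N => ?_, fun e he N => ?_,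
    ?_⟩
  · simp only [hx]; exact hstep _
  · exact (hF N).imp fun n hn => ⟨hn.1, hn.2.1⟩
  · obtain ⟨n, hn, hf⟩ := hF N
    obtain ⟨t, ht, hte⟩ := hf.2.2 e he
    obtain ⟨k, hk⟩ := Nat.exists_eq_succ_of_ne_zero
      (mt List.length_eq_zero_iff.1 (x n).2.1)
    obtain ⟨i, -, rfl⟩ := (key k n hk).2 t ht
    exact ⟨n + i, by omega, hte⟩
  · obtain ⟨N, -, hN⟩ := hF 0
    -- Only the initial path may contain unsafe steps. From the first fresh state on, every pending
    -- list is a tail of a safe segment.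
    have hsafe : ∀ n ≥ N, ∀ t ∈ (x n).1.2, t.Safe := by
      intro n hn
      induction n, hn using Nat.le_induction with
      | base => exact hN.2.1
      | succ n hn ih =>
        rw [hx]
        by_cases hl : rest (x n) = []
        · exact (hfresh _ hl).2.1
        · rw [hcont _ hl]
          intro t ht
          exact ih t (by rw [hrest]; exact List.mem_cons_of_mem _ ht)
    exact ⟨N, fun n hn => hsafe n hn _ (by rw [hrest]; exact List.mem_cons_self)⟩

end Infinite

/-! ## The scenario -/

/-! ### Computations with routing tables and stores. -/

section Tables

open scoped Classical in
theorem update_of_none {rt : RT IP} {dip : IP} {r : Route IP} (h : rt dip = none)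
    (hf : r.flag = .val) (hk : r.dsn = 0 ↔ r.dsk = .unk) (hh : r.dsk = .unk → r.hops = 1) :
    update rt dip r = some (Function.update rt dip (some r)) := by
  rw [update, if_pos ⟨hf, hk, hh⟩, h]

open scoped Classical in
theorem update_of_lt {rt : RT IP} {dip : IP} {r s : Route IP} (h : rt dip = some s)
    (hf : r.flag = .val) (hk : r.dsn = 0 ↔ r.dsk = .unk) (hh : r.dsk = .unk → r.hops = 1)
    (hs : s.dsn < r.dsn) :
    update rt dip r = some (Function.update rt dip (some (addpre r s.pre))) := by
  rw [update, if_pos ⟨hf, hk, hh⟩, h]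
  simp only [if_pos hs]

theorem brokenDests_eq_singleDest {rt : RT IP} {x : IP} {e : Route IP} (he : rt x = some e)
    (hf : e.flag = .val) (h : ∀ y ≠ x, nhop rt y ≠ some e.nhip) :
    brokenDests rt x = singleDest x (inc e.dsn) := by
  funext y
  by_cases hy : y = x
  · subst hy
    simp [brokenDests, singleDest, vD, he, hf, sqn]
  · have : nhop rt x = some e.nhip := by simp [nhop, he]
    simp [brokenDests, singleDest, hy, this, h y hy]

/-- Invalidation does not touch precursors; the addressees of the error message are therefore those
recorded before the break. -/
theorem allPrecs_invalidate_singleDest {rt : RT IP} {x : IP} {e : Route IP} (he : rt x = some e)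
    (n : ℕ) : allPrecs (invalidate rt (singleDest x n)) (singleDest x n) = e.pre := by
  ext z
  constructor
  · rintro ⟨y, hy, P, hP, hz⟩
    have hyx : y = x := by
      by_contra hne
      simp [singleDest, hne] at hy
    subst hyx
    simp only [precs, invalidate, he, singleDest, Function.update_self, Option.map_some,
      Option.some.injEq] at hP
    rwa [hP]
  · exact fun hz => ⟨x, by simp [singleDest], e.pre,
      by simp [precs, invalidate, he, singleDest], hz⟩

/-- Only a new queue gets the flag `req`; a packet appended to an existing queue inherits its flag.
Thus further packets at the target never reactivate its route discovery. -/
theorem qflag_add_ne_req {store : Store IP DATA} {dip : IP} (d : DATA)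
    (hd : qflag store dip = some .noreq) (h : ∀ x, qflag store x ≠ some .req) :
    qflag (add d dip store) dip = some .noreq ∧ ∀ x, qflag (add d dip store) x ≠ some .req := by
  obtain ⟨⟨p, q⟩, hq, rfl⟩ : ∃ pq, store dip = some pq ∧ pq.1 = .noreq := by
    simpa [qflag] using hd
  have key : qflag (add d dip store) dip = some .noreq := by simp [qflag, add, hq]
  refine ⟨key, fun x => ?_⟩
  by_cases hx : x = dip
  · rw [hx, key]; simp
  · have := h x
    simpa [qflag, add, hx] using this

end Tables

/-! ### The relay loses its route to the target without telling anyone. -/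

section Nodes

variable {ν : NodeState IP DATA} {ip : IP} {sn : ℕ} {rt : RT IP} {rreqs : Set (IP × ℕ)}
  {store : Store IP DATA} {ms : List (Msg IP DATA)} {R : Set IP}
  {Q : Valuation IP DATA → SP IP DATA → Prop}

theorem IsNode.ofIdle (h : IsNode (Idle ip sn rt rreqs store) ms R ν)
    (hQ : ∀ ξ, Core ξ ip sn rt rreqs store → Q ξ (callSame .AODV)) : IsNode Q ms R ν :=
  ⟨by rw [h.main.1]; exact hQ _ h.main.2, h.queue, h.range⟩

open scoped Classical in
/-- Handling of a route reply for `s` by a node that has lost the link towards the originator `t` of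
the request, to which it has a route without precursors. -/
theorem handles_rrep_lost {s t : IP} {k n : ℕ} (hst : s ≠ t) (ht : t ≠ ip) (hk : k ≠ 0) :
    ∃ (m m' : Msg IP DATA) (rt' : RT IP), (∃ r, rt' t = some r ∧ r.flag = .inval ∧ r.pre = ∅) ∧
      ∀ ξ, Core ξ ip sn (Function.update (fun _ => none) t (some ⟨n, .kno, .val, 1, t, ∅⟩))
        rreqs (fun _ => none) →
      Acts (.receive (.rrep 0 s k t s)) (Reaches (Acts (.notUnicast t m) (Reaches
        (Acts (.groupcast ∅ m') (Idle ip sn rt' rreqs fun _ => none))))) ξ (callSame .AODV) := by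
  set e : Route IP := ⟨n, .kno, .val, 1, t, ∅⟩ with he
  set rt : RT IP := Function.update (fun _ => none) t (some e) with hrt
  set f : Route IP := addpre ⟨k, .kno, .val, 0 + 1, s, ∅⟩ ∅ with hf
  -- The next hop for `s` is `s` itself, so both additions of the precursor `t` concern the entry
  -- for `s`. The entry for `t` keeps its empty set of precursors: this is the flaw of the protocol.
  set rt₄ : RT IP := Function.update rt s (some (addpre (addpre f {t}) {t})) with hrt₄
  have h₁ : update rt s ⟨0, .unk, .val, 1, s, ∅⟩ = some (Function.update rt s (some _)) :=
    update_of_none (by simp [hrt, hst]) rfl (by simp) (by simp)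
  have h₂ : update (Function.update rt s (some ⟨0, .unk, .val, 1, s, ∅⟩)) s
      ⟨k, .kno, .val, 0 + 1, s, ∅⟩ = some (Function.update rt s (some f)) := by
    rw [update_of_lt (Function.update_self ..) rfl (by simp [hk]) (by simp)
      (Nat.pos_of_ne_zero hk), Function.update_idem]
  have h₃ : addpreRT (Function.update rt s (some f)) s {t} =
      some (Function.update rt s (some (addpre f {t}))) := by simp [addpreRT]
  have h₄ : addpreRT (Function.update rt s (some (addpre f {t}))) s {t} = some rt₄ := by
    simp [addpreRT, hrt₄]
  have het : rt₄ t = some e := by simp [hrt₄, hst.symm, hrt]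
  -- The only other entry is the one for `s`, whose next hop is `s`; hence `t` is the only
  -- destination lost.
  have hb : brokenDests rt₄ t = singleDest t (inc e.dsn) := by
    refine brokenDests_eq_singleDest het rfl fun y hy => ?_
    by_cases hys : y = s
    · subst hys
      simp [hrt₄, nhop, hf, addpre, he, hst]
    · simp [hrt₄, hrt, hy, hys, nhop]
  have hall := allPrecs_invalidate_singleDest het (inc e.dsn)
  have key := fun ξ (h : Core (DATA := DATA) ξ ip sn rt rreqs fun _ => none) =>
    handles_rrep_linkBreak h h₁ h₂ (fun hc => by
      have := congrFun hc s
      simp [hf, addpre] at this) ht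
    (by simp [vD, hst.symm, hrt, he]) (nho := t) (by simp [nhop, hst.symm, hrt, he]) h₃
    (nhd := s) (by simp [nhop, hf, addpre]) (by simp [nhop, hst.symm, hrt, he]) h₄
    (by simp [nhop, het, he]) hb rfl
  rw [hall] at key
  exact ⟨_, _, _, ⟨{ e with dsn := inc e.dsn, flag := .inval },
    by simp [invalidate, het, singleDest], rfl, rfl⟩, key⟩

end Nodes

/-- The range of the nodes in the line topology. -/
def lineRange (addr : Role → IP) : Role → Set IP
  | .source => {addr .relay}
  | .relay => {addr .source, addr .target}
  | .target => {addr .relay}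

def initConfig (addr : Role → IP) : Config IP DATA := fun i =>
  ⟨initMain (addr i), callSame .AODV, initQueue, callSame .QMSG, lineRange addr i⟩

theorem initConfig_isNode (addr : Role → IP) (i : Role) :
    IsNode (Idle (addr i) 1 (fun _ => none) ∅ fun _ => none) [] (lineRange addr i)
      (initConfig (DATA := DATA) addr i) :=
  ⟨⟨rfl, rfl, rfl, rfl, rfl, rfl⟩, ⟨_, rfl, rfl⟩, rfl⟩

/-- The source has a valid route to the target via the relay, but the relay has an invalid route to
the target, without precursors. -/
structure Stale (addr : Role → IP) (c : Config IP DATA) : Prop where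
  source : ∃ sn rt rreqs, IsNode (Idle (addr .source) sn rt rreqs fun _ => none) []
    {addr .relay} (c .source) ∧
      ∃ r, rt (addr .target) = some r ∧ r.flag = .val ∧ r.nhip = addr .relay
  relay : ∃ sn rt rreqs R, IsNode (Idle (addr .relay) sn rt rreqs fun _ => none) [] R (c .relay) ∧
    addr .target ∈ R ∧ ∃ r, rt (addr .target) = some r ∧ r.flag = .inval ∧ r.pre = ∅
  target : ∃ sn rreqs store R, IsNode (Idle (addr .target) sn (fun _ => none) rreqs store) [] R
    (c .target) ∧ qflag store (addr .source) = some .noreq ∧ ∀ x, qflag store x ≠ some .req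

/-! ### The path to the stale situation, and the loop that loses packets. -/

section Scenario

variable {addr : Role → IP}

def loopEvents (addr : Role → IP) (d : DATA) : List (Event IP DATA) :=
  [.newpkt (addr .source) d (addr .target), .sync .source, .sync .relay,
    .newpkt (addr .target) d (addr .source), .sync .target]

/-- Data packets never change a routing table as long as unicasts succeed. The source reaches the
relay without failure, and the relay drops the packet after an error message to the empty set of
precursors, so the stale routes persist. -/
theorem Stale.reach (haddr : addr.Injective) (d : DATA) {c : Config IP DATA} (h : Stale addr c) :
    ∃ c', Reach addr c (loopEvents addr d) c' ∧ Stale addr c' := by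
  obtain ⟨⟨sn, rt, rreqs, hs, e, he, hev, hen⟩,
    ⟨sn', rt', rreqs', R', hr, htR, e', he', hev', hep'⟩, sn'', rreqs'', store, R'', ht, hq,
    hq'⟩ := h
  have hst : addr .target ≠ addr .source := haddr.ne (by decide)
  have hrt : addr .target ≠ addr .relay := haddr.ne (by decide)
  obtain ⟨c₁, r₁, hs, o₁⟩ := reach_newpkt (addr := addr) hs d (addr .target)
  obtain ⟨c₂, r₂, hs, o₂⟩ := reach_handle (addr := addr)
    (hs.ofIdle fun ξ hξ => handles_newpkt hξ hst)
  obtain ⟨c₃, r₃, hs, o₃⟩ := reach_reaches (addr := addr) (hs.ofIdle fun ξ hξ =>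
    reaches_unicast_pkt hξ (nh := addr .relay) (data := d) (store' := fun _ => none)
      (dip := addr .target) ⟨by simp [qD, add], e, he, hev⟩ (by simp [selqueue, add])
      (by simp [nhop, he, hen]) (by simp [drop, add]))
  -- The facts about nodes that did not move are carried along to the current configuration; this
  -- recurs after each group of moves.
  rw [← o₁ .relay (by decide), ← o₂ .relay (by decide), ← o₃ .relay (by decide)] at hr
  rw [← o₁ .target (by decide), ← o₂ .target (by decide), ← o₃ .target (by decide)] at ht
  obtain ⟨c₄, r₄, hs, hr, o₄⟩ := reach_cast (addr := addr) hs (by simp) (.unicast rfl)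
    (j := .relay) (by decide) hr rfl (fun k _ hk => by simpa using haddr.ne hk)
  obtain ⟨c₅, r₅, hs, o₅⟩ := reach_reaches (addr := addr) hs
  rw [← o₅ .relay (by decide)] at hr
  obtain ⟨c₆, r₆, hr, o₆⟩ := reach_handle (addr := addr)
    (hr.ofIdle fun ξ hξ => handles_pkt_noRoute hξ hrt (P := ∅) (by simp [vD, he', hev'])
      (by simp [iD, he', hev']) (by simp [precs, he', hep']))
  obtain ⟨c₇, r₇, hr, o₇⟩ := reach_groupcast_empty (addr := addr) hr
  rw [← o₄ .target (by decide) (by decide), ← o₅ .target (by decide), ← o₆ .target (by decide),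
    ← o₇ .target (by decide)] at ht
  -- This packet only keeps the target active. It joins the waiting queue for the source and is
  -- never sent.
  obtain ⟨c₈, r₈, ht, o₈⟩ := reach_newpkt (addr := addr) ht d (addr .source)
  obtain ⟨c₉, r₉, ht, o₉⟩ := reach_handle (addr := addr)
    (ht.ofIdle fun ξ hξ => handles_newpkt hξ hst.symm)
  rw [← o₆ .source (by decide), ← o₇ .source (by decide), ← o₈ .source (by decide),
    ← o₉ .source (by decide)] at hs
  rw [← o₈ .relay (by decide), ← o₉ .relay (by decide)] at hr
  exact ⟨c₉, r₁.trans <| r₂.trans <| r₃.trans <| r₄.trans <| r₅.trans <| r₆.trans <| r₇.trans <|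
    r₈.trans r₉, ⟨_, _, _, hs, e, he, hev, hen⟩, ⟨_, _, _, _, hr, htR, e', he', hev', hep'⟩,
    _, _, _, _, ht, qflag_add_ne_req d hq hq'⟩

theorem exists_step_disconnect (haddr : addr.Injective) {c : Config IP DATA} {Q₁ Q₂ Q₃ ms₁ ms₂ ms₃}
    {R₁ R₂ R₃ : Set IP} (hs : IsNode Q₁ ms₁ R₁ (c .source)) (hr : IsNode Q₂ ms₂ R₂ (c .relay))
    (ht : IsNode Q₃ ms₃ R₃ (c .target)) :
    ∃ t c', ConfigStep addr c t c' ∧ IsNode Q₁ ms₁ R₁ (c' .source) ∧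
      IsNode Q₂ ms₂ (R₂ \ {addr .target}) (c' .relay) ∧
      IsNode Q₃ ms₃ (R₃ \ {addr .relay}) (c' .target) := by
  have h₁ : addr .source ≠ addr .relay := haddr.ne (by decide)
  have h₂ : addr .source ≠ addr .target := haddr.ne (by decide)
  obtain ⟨t, ht'⟩ := configStep_disconnect (addr := addr) (c := c) (x := addr .relay)
    (y := addr .target) (fun
      | .source => c .source
      | .relay => { c .relay with R := (c .relay).R \ {addr .target} }
      | .target => { c .target with R := (c .target).R \ {addr .relay} }) (fun
      | .source => ⟨_, .disconnectOther ⟨h₁, h₂⟩, rfl⟩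
      | .relay => ⟨_, .disconnectL, rfl⟩
      | .target => ⟨_, .disconnectR, rfl⟩)
  exact ⟨t, _, ht', hs, ⟨hr.main, hr.queue, by rw [hr.range]⟩, ht.main, ht.queue, by rw [ht.range]⟩

theorem exists_step_connect (haddr : addr.Injective) {c : Config IP DATA} {Q₁ Q₂ Q₃ ms₁ ms₂ ms₃}
    {R₁ R₂ R₃ : Set IP} (hs : IsNode Q₁ ms₁ R₁ (c .source)) (hr : IsNode Q₂ ms₂ R₂ (c .relay))
    (ht : IsNode Q₃ ms₃ R₃ (c .target)) :
    ∃ t c', ConfigStep addr c t c' ∧ IsNode Q₁ ms₁ R₁ (c' .source) ∧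
      IsNode Q₂ ms₂ (R₂ ∪ {addr .target}) (c' .relay) ∧
      IsNode Q₃ ms₃ (R₃ ∪ {addr .relay}) (c' .target) := by
  have h₁ : addr .source ≠ addr .relay := haddr.ne (by decide)
  have h₂ : addr .source ≠ addr .target := haddr.ne (by decide)
  obtain ⟨t, ht'⟩ := configStep_connect (addr := addr) (c := c) (x := addr .relay)
    (y := addr .target) (fun
      | .source => c .source
      | .relay => { c .relay with R := (c .relay).R ∪ {addr .target} }
      | .target => { c .target with R := (c .target).R ∪ {addr .relay} }) (fun
      | .source => ⟨_, .connectOther ⟨h₁, h₂⟩, rfl⟩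
      | .relay => ⟨_, .connectL, rfl⟩
      | .target => ⟨_, .connectR, rfl⟩)
  exact ⟨t, _, ht'.1, hs, ⟨hr.main, hr.queue, by rw [hr.range]⟩, ht.main, ht.queue,
    by rw [ht.range]⟩

open scoped Classical in
theorem exists_path_stale (haddr : addr.Injective) (d : DATA) :
    ∃ (l : List (Tick IP DATA)) (c : Config IP DATA),
      Path addr (initConfig addr) l c ∧ Stale addr c := by
  have hst : addr .source ≠ addr .target := haddr.ne (by decide)
  have hsr : addr .source ≠ addr .relay := haddr.ne (by decide)
  have htr : addr .target ≠ addr .relay := haddr.ne (by decide)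
  have hs := initConfig_isNode (DATA := DATA) addr .source
  have hr := initConfig_isNode (DATA := DATA) addr .relay
  have ht := initConfig_isNode (DATA := DATA) addr .target
  -- Safety and events are discarded here and below: the path to the stale situation contains a
  -- disconnection, and only its existence matters.
  obtain ⟨c₁, ⟨l₁, p₁, -⟩, ht, o₁⟩ := reach_newpkt (addr := addr) ht d (addr .source)
  obtain ⟨c₂, ⟨l₂, p₂, -⟩, ht, o₂⟩ := reach_handle (addr := addr)
    (ht.ofIdle fun ξ hξ => handles_newpkt hξ hst)
  obtain ⟨c₃, ⟨l₃, p₃, -⟩, ht, o₃⟩ := reach_reaches (addr := addr) (ht.ofIdle fun ξ hξ =>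
    reaches_broadcast_rreq hξ (dip := addr .source) ⟨by simp [qD, add], by simp [vD]⟩
      (by simp [qflag, add]))
  rw [← o₁ .relay (by decide), ← o₂ .relay (by decide), ← o₃ .relay (by decide)] at hr
  rw [← o₁ .source (by decide), ← o₂ .source (by decide), ← o₃ .source (by decide)] at hs
  obtain ⟨c₄, ⟨l₄, p₄, -⟩, ht, hr, o₄⟩ := reach_cast (addr := addr) ht (by simp) .broadcast
    (j := .relay) (by decide) hr rfl (fun k _ hk => by simpa [lineRange] using haddr.ne hk)
  rw [← o₄ .source (by decide) (by decide)] at hs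
  -- The link breaks while the request is waiting in the queue of the relay. When the request is
  -- handled, the relay thus installs a route over a link that is gone, and its own broadcast
  -- reaches the source only.
  obtain ⟨t₅, c₅, p₅, hs, hr, ht⟩ := exists_step_disconnect haddr hs hr ht
  -- The target increments its initial sequence number before it broadcasts, so the routes to it
  -- carry the number 2.
  have hinc : inc 1 = 2 := rfl
  obtain ⟨c₆, ⟨l₆, p₆, -⟩, hr, o₆⟩ := reach_handle (addr := addr)
    (hr.ofIdle fun ξ hξ => handles_rreq_forward hξ
      (rt₂ := Function.update (fun _ => none) (addr .target)
        (some ⟨2, .kno, .val, 1, addr .target, ∅⟩))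
      (update_of_none rfl rfl (by simp) (by simp)) (by simp)
      (by
        rw [update_of_lt (Function.update_self ..) rfl (by simp [hinc]) (by simp) (by simp [hinc])]
        simp [addpre, hinc])
      hsr (by simp [vD, hst]))
  rw [← o₆ .source (by decide)] at hs
  obtain ⟨c₇, ⟨l₇, p₇, -⟩, hr, hs, o₇⟩ := reach_cast (addr := addr) hr (by simp) .broadcast
    (j := .source) (by decide) hs (by simp [lineRange, hst]) (fun k h₁ h₂ => by
      cases k <;> simp_all)
  rw [← o₆ .target (by decide), ← o₇ .target (by decide) (by decide)] at ht
  obtain ⟨c₈, ⟨l₈, p₈, -⟩, hs, o₈⟩ := reach_handle (addr := addr)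
    (hs.ofIdle fun ξ hξ => handles_rreq_reply hξ (nh := addr .relay)
      (update_of_none rfl rfl (by simp) (by simp)) (by simp)
      (update_of_none (by simp [htr]) rfl (by simp [hinc]) (by simp))
      (by simp [nhop]))
  rw [← o₈ .relay (by decide)] at hr
  obtain ⟨c₉, ⟨l₉, p₉, -⟩, hs, hr, o₉⟩ := reach_cast (addr := addr) hs (by simp)
    (.unicast rfl) (j := .relay) (by decide) hr rfl
    (fun k _ hk => by simpa using haddr.ne hk)
  rw [← o₈ .target (by decide), ← o₉ .target (by decide) (by decide)] at ht
  -- The number `k` is the one in the reply of the source: the maximum of its own sequence number 1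
  -- and the number in the forwarded request, in particular nonzero.
  obtain ⟨m, m', rt', ⟨r, hr₁, hr₂, hr₃⟩, key⟩ := handles_rrep_lost (DATA := DATA)
    (ip := addr .relay) (sn := 1) (rreqs := ∅ ∪ {(addr .target, nrreqid ∅ (addr .target))})
    (n := 2) (s := addr .source) (t := addr .target) hst htr
    (k := max 1 (max (sqn (Function.update (fun _ => none) (addr .target)
        (some ⟨2, .kno, .val, 1, addr .target, ∅⟩)) (addr .source))
      (sqn (fun _ => none) (addr .source)))) (by simp)
  obtain ⟨c₁₀, ⟨l₁₀, p₁₀, -⟩, hr, o₁₀⟩ := reach_handle (addr := addr) (hr.ofIdle key)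
  obtain ⟨c₁₁, ⟨l₁₁, p₁₁, -⟩, hr, o₁₁⟩ := reach_notUnicast (addr := addr) hr (by simp)
  obtain ⟨c₁₂, ⟨l₁₂, p₁₂, -⟩, hr, o₁₂⟩ := reach_reaches (addr := addr) hr
  obtain ⟨c₁₃, ⟨l₁₃, p₁₃, -⟩, hr, o₁₃⟩ := reach_groupcast_empty (addr := addr) hr
  rw [← o₁₀ .source (by decide), ← o₁₁ .source (by decide), ← o₁₂ .source (by decide),
    ← o₁₃ .source (by decide)] at hs
  rw [← o₁₀ .target (by decide), ← o₁₁ .target (by decide), ← o₁₂ .target (by decide),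
    ← o₁₃ .target (by decide)] at ht
  -- Restoring the link makes source and target connected again, but does not revalidate the entry
  -- of the relay.
  obtain ⟨t₁₄, c₁₄, p₁₄, hs, hr, ht⟩ := exists_step_connect haddr hs hr ht
  refine ⟨_, c₁₄, p₁.trans <| p₂.trans <| p₃.trans <| p₄.trans <| .cons p₅ <| p₆.trans <|
    p₇.trans <| p₈.trans <| p₉.trans <| p₁₀.trans <| p₁₁.trans <| p₁₂.trans <| p₁₃.trans <|
    .cons p₁₄ (.nil _), ⟨_, _, _, hs, _, Function.update_self .., rfl, rfl⟩,
    ⟨_, _, _, _, hr, by simp, r, hr₁, hr₂, hr₃⟩, _, _, _, _, ht, ?_, fun x => ?_⟩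
  · simp [qflag, unsetRRF, add]
  · by_cases hx : x = addr .source <;> simp [qflag, unsetRRF, add, hx]

end Scenario

/-! ### Fairness of the path and failure of packet delivery. -/

section Violation

variable {addr : Role → IP} {c : Config IP DATA}

theorem hasNode_net_iff {ip : IP} {P : PP IP DATA} {R : Set IP} :
    (c.net addr).HasNode ip P R ↔ ∃ i, ip = addr i ∧ P = (c i).proc ∧ R = (c i).R := by
  constructor
  · rintro (⟨h₁, h₂, h₃⟩ | ⟨h₁, h₂, h₃⟩ | ⟨h₁, h₂, h₃⟩)
    exacts [⟨.source, h₁.symm, h₂.symm, h₃.symm⟩, ⟨.relay, h₁.symm, h₂.symm, h₃.symm⟩,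
      ⟨.target, h₁.symm, h₂.symm, h₃.symm⟩]
  · rintro ⟨i, rfl, rfl, rfl⟩
    cases i
    exacts [.inl ⟨rfl, rfl, rfl⟩, .inr (.inl ⟨rfl, rfl, rfl⟩), .inr (.inr ⟨rfl, rfl, rfl⟩)]

/-- Atomic propositions quantify over the nodes that carry a given address. This reduces them to the
known state of one of the three nodes and shows that other addresses satisfy none of them. -/
theorem storeRT_eq {ip : IP} {st : Store IP DATA} {rt : RT IP}
    (h : (c.net addr).StoreRT ip st rt) : ∃ i, ip = addr i ∧
      ∀ {sn rt' rreqs st' ms R}, IsNode (Idle (addr i) sn rt' rreqs st') ms R (c i) →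
        st = st' ∧ rt = rt' := by
  obtain ⟨ξ, ⟨p, Q, R, hn⟩, hst, hrt⟩ := h
  obtain ⟨i, rfl, hp, -⟩ := hasNode_net_iff.1 hn
  obtain ⟨⟨rfl, -⟩, -⟩ : (ξ = (c i).ξ ∧ p = (c i).p) ∧ Q = _ := by
    simpa [NodeState.proc] using hp
  refine ⟨i, rfl, fun h => ⟨?_, ?_⟩⟩
  · have := hst.symm.trans h.main.2.store; simpa using this
  · have := hrt.symm.trans h.main.2.rt; simpa using this

/-- Refutes the premises of the first two fairness conditions, for every address and every
destination. -/
theorem Stale.storeRT (h : Stale addr c) {ip : IP} {st : Store IP DATA} {rt : RT IP}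
    (hst : (c.net addr).StoreRT ip st rt) :
    (∀ dip, qflag st dip ≠ some .req) ∧ (∀ dip, dip ∉ qD st ∩ vD rt) := by
  obtain ⟨i, rfl, hi⟩ := storeRT_eq hst
  cases i with
  | source =>
    obtain ⟨_, _, _, hn, -⟩ := h.source
    obtain ⟨rfl, rfl⟩ := hi hn
    simp [qflag, qD]
  | relay =>
    obtain ⟨_, _, _, _, hn, -⟩ := h.relay
    obtain ⟨rfl, rfl⟩ := hi hn
    simp [qflag, qD]
  | target =>
    obtain ⟨_, _, _, _, hn, -, hq⟩ := h.target
    obtain ⟨rfl, rfl⟩ := hi hn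
    exact ⟨hq, by simp [vD]⟩

theorem Stale.storeRT_source (haddr : addr.Injective) (h : Stale addr c) {st : Store IP DATA}
    {rt : RT IP} (hst : (c.net addr).StoreRT (addr .source) st rt) (dip : IP) : dip ∉ qD st := by
  obtain ⟨i, he, hi⟩ := storeRT_eq hst
  obtain rfl := haddr he
  obtain ⟨_, _, _, hn, -⟩ := h.source
  obtain ⟨rfl, rfl⟩ := hi hn
  simp [qD]

theorem Stale.connected (h : Stale addr c) :
    Relation.ReflTransGen (fun x y => ∃ P R, (c.net addr).HasNode x P R ∧ y ∈ R)
      (addr .source) (addr .target) := by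
  obtain ⟨_, _, _, hs, -⟩ := h.source
  obtain ⟨_, _, _, _, hr, htR, -⟩ := h.relay
  refine .tail (.single ⟨_, _, hasNode_net_iff.2 ⟨.source, rfl, rfl, rfl⟩, ?_⟩)
    ⟨_, _, hasNode_net_iff.2 ⟨.relay, rfl, rfl, rfl⟩, ?_⟩
  · rw [hs.range]; rfl
  · rw [hr.range]; exact htR

theorem initConfig_isInitial (haddr : addr.Injective) :
    ((initConfig addr : Config IP DATA).net addr).IsInitial := by
  have h₁ : addr .source ≠ addr .relay := haddr.ne (by decide)
  have h₂ : addr .source ≠ addr .target := haddr.ne (by decide)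
  have h₃ : addr .relay ≠ addr .target := haddr.ne (by decide)
  refine ⟨by simp [Config.net, Net.addrs, h₁, h₂, h₃], fun ip P R hn => ?_,
    fun ip P R ip' P' R' hn hn' => ?_⟩
  · obtain ⟨i, rfl, rfl, rfl⟩ := hasNode_net_iff.1 hn
    refine ⟨rfl, ?_, ?_⟩
    · cases i <;> simp [initConfig, lineRange, h₁, h₁.symm, h₃, h₃.symm]
    · cases i <;> simp [initConfig, lineRange, Config.net, Net.addrs]
  · obtain ⟨i, rfl, rfl, rfl⟩ := hasNode_net_iff.1 hn
    obtain ⟨j, rfl, rfl, rfl⟩ := hasNode_net_iff.1 hn'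
    cases i <;> cases j <;>
      simp [initConfig, lineRange, h₁, h₂, h₃, h₁.symm, h₂.symm, h₃.symm]

/-- Each packet from the source to the target is lost at the relay. -/
theorem not_satisfies_packetDelivery (haddr : addr.Injective) (d : DATA) :
    ¬ Satisfies ((initConfig addr : Config IP DATA).net addr)
      (packetDelivery (addr .source) (addr .target) d) := by
  intro hsat
  obtain ⟨l, c₁, hpath, hstale⟩ := exists_path_stale haddr d
  obtain ⟨c, t, hc₀, hstep, hP, hev, N, hsafe⟩ := exists_infinite_path (es := loopEvents addr d)
    (by simp [loopEvents]) hpath hstale fun c hc => hc.reach haddr d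
  have hsync : ∀ i N, ∃ n ≥ N, (t n).IsSync addr i := fun i N => by
    cases i
    exacts [hev (.sync .source) (by simp [loopEvents]) N,
      hev (.sync .relay) (by simp [loopEvents]) N, hev (.sync .target) (by simp [loopEvents]) N]
  -- The `n`-th state of the path sits at the even position `2 * n`; transitions, as used in
  -- `htrans`, sit at odd positions.
  have hstate : ∀ k, ∃ j ≥ k, ∃ n, (netRun addr c t).state ((j + 1) / 2) = (c n).net addr ∧
      Stale addr (c n) := fun k => by
    obtain ⟨n, hn, hs⟩ := hP k
    exact ⟨2 * n, by omega, n, by rw [show (2 * n + 1) / 2 = n by omega]; rfl, hs⟩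
  have htrans : ∀ {φ : NLab IP DATA → Prop}, (∀ k, ∃ n ≥ k, φ (t n).lab) → ∀ k,
      (LTL.F (.trans φ)).Holds (netRun addr c t) k := fun {φ} h k => by
    obtain ⟨n, hn, hφ⟩ := h k
    exact ⟨2 * n + 1, by omega, by omega, (t n).lab,
      by rw [show (2 * n + 1) / 2 = n by omega]; rfl, hφ⟩
  have hPD := hsat (netRun addr c t) (by rw [← hc₀]; rfl) (netRun_complete hstep hsync)
    (fun ip dip k _ hG => by
      obtain ⟨j, hj, n, hn, hs⟩ := hstate k
      obtain ⟨st, rt, hst, hd⟩ := hG j hj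
      exact absurd hd ((hs.storeRT (hn ▸ hst)).2 dip))
    (fun ip dip k _ hG => by
      obtain ⟨j, hj, n, hn, hs⟩ := hstate k
      obtain ⟨-, st, rt, hst, hd⟩ := hG j hj
      exact absurd hd ((hs.storeRT (hn ▸ hst)).1 dip))
    -- The premise is needed only to know that `ip` is one of the three nodes; the queues of these
    -- send infinitely often anyway.
    (fun ip k _ hG => by
      obtain ⟨j, hj, n, hn, -⟩ := hstate k
      obtain ⟨ζ, -, ⟨P, q, R, hnode⟩, -⟩ := hG j hj
      rw [hn] at hnode
      obtain ⟨i, rfl, -⟩ := hasNode_net_iff.1 hnode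
      exact htrans (fun k => (hsync i k).imp fun n hn => ⟨hn.1, hn.2.sends⟩) k)
    -- The antecedent of packet delivery: the source cannot have queued packets forever, as its
    -- store is empty whenever the stale situation recurs.
    (fun k _ hG => by
      obtain ⟨j, hj, n, hn, hs⟩ := hstate k
      obtain ⟨st, rt, hst, hd⟩ := hG j hj
      exact absurd hd.1 (hs.storeRT_source haddr (hn ▸ hst) _))
  obtain ⟨n, hn, hs⟩ := hP N
  obtain ⟨j, hj, (⟨-, ℓ, hℓ, hd⟩ | ⟨-, ℓ, hℓ, x, y, hd⟩) | hd⟩ := hPD (2 * n) (by omega) (by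
    have := hs.connected
    simp only [connectedStar, LTL.Holds]
    rwa [show (2 * n + 1) / 2 = n by omega])
  · obtain rfl : (t (j / 2)).lab = ℓ := Option.some.inj hℓ
    exact (hsafe (j / 2) (by omega)).1 _ _ hd
  · obtain rfl : (t (j / 2)).lab = ℓ := Option.some.inj hℓ
    exact (hsafe (j / 2) (by omega)).2 _ _ hd
  -- The remaining excuse, that the packet is no longer injected, fails since each round injects it
  -- again.
  · exact hd (htrans (fun k => hev (.newpkt (addr .source) d (addr .target))
      (by simp [loopEvents]) k) j)

theorem exists_injective_role (h : 3 ≤ ENat.card IP) : ∃ addr : Role → IP, addr.Injective := by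
  rw [← Set.encard_univ] at h
  obtain ⟨S, -, hS⟩ := Set.exists_subset_encard_eq h
  obtain ⟨a, b, c, hab, hac, hbc, -⟩ := Set.encard_eq_three.1 hS
  refine ⟨fun | .source => a | .relay => b | .target => c, fun i j hij => ?_⟩
  cases i <;> cases j <;> simp_all

end Violation

end

end AODV

theorem mainTheorem6 (IP DATA : Type) (hIP : 3 ≤ ENat.card IP) (hDATA : Nonempty DATA) :
    ¬ AODV.SatisfiesPacketDelivery IP DATA := by
  obtain ⟨addr, haddr⟩ := AODV.exists_injective_role hIP
  obtain ⟨d⟩ := hDATA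
  intro h
  exact AODV.not_satisfies_packetDelivery haddr d
    (h _ (AODV.initConfig_isInitial haddr) _ (by simp [AODV.Config.net, AODV.Net.addrs]) _
      (by simp [AODV.Config.net, AODV.Net.addrs]) d)
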